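/- **Theorem (Formula for coordinate changes).** Let $M=(M_0,\mathcal O_M)$ be a real supermanifold of dimension $(p,q)$ with canonical embedding $j\colon M_0\to M$, where $M_0$ is Hausdorff and second countable, and let $U\subseteq M$ be an open subspace with underlying open set $U_0$ which admits a coordinate system (a coordinate neighbourhood). *Conventions.* A retraction on $U$ is a morphism $\gamma\colon U\to U_0$ with $\gamma\circ j=\mathrm{id}_{U_0}$. A coordinate system $x=(u,\xi)$ on $U$ has the associated retraction $\gamma$ if $\gamma^*(u_0)=u$, where $u_0=j^*(u)$; each superfunction is then uniquely $f=\sum_{\nu\in\{0,1\}^q}\gamma^*(f_\nu)\xi^\nu$ with $f_\nu\in C^\infty(U_0)$, and $\frac{\partial f}{\partial u_l}=\sum_\nu\gamma^*\bigl(\frac{\partial f_\nu}{\partial u_{0,l}}\bigr)\xi^\nu$. A Berezin form on $U$ is an expression $\omega=f\,Dx$, subject to $f\,Dx=f\,\frac{Dx}{Dy}\,Dy$ for any other coordinate system $y=(v,\eta)$ on $U$, where $\frac{Dx}{Dy}=\det(R-SV^{-1}T)\det V^{-1}$ with $R=\frac{\partial u}{\partial v}$, $S=\frac{\partial\xi}{\partial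 v}$, $T=\frac{\partial u}{\partial\eta}$, $V=\frac{\partial\xi}{\partial\eta}$; a Berezin density is an expression $f\,|Dx|$, subject to $f\,|Dx|=f\,\operatorname{sgn}\det\bigl(\frac{\partial u_0}{\partial v_0}\bigr)\frac{Dx}{Dy}\,|Dy|$. With a fixed choice of a sign $(-1)^{s}$, $s=s(p,q)$, one puts $\gamma_!(f|Dx|)=(-1)^{s}f_{(1,\dots,1)}|du_0|$ and $\gamma_!(f\,Dx)=(-1)^{s}f_{(1,\dots,1)}\,du_0$ for any coordinate system $x=(u,\xi)$ with associated retraction $\gamma$. One says that $\omega$ is integrable with respect to $\gamma$ if $\gamma_!\omega$ is integrable on $U_0$, and puts $\int_{(U,\gamma)}\omega=\int_{U_0}\gamma_!\omega$; for forms, $U_0$ is assumed to be oriented. The even vector fields $\partial_{u_l}$ act from the right by $\omega.\partial_{u_l}=-\mathcal L_{\partial_{u_l}}\omega$, that is, $(f|Dx|).\partial_{u_l}=-\frac{\partial f}{\partial u_l}|Dx|$ (and likewise for $f\,Dx$), and $\omega.\partial_u^i$ is the corresponding iterated action for $i\in\mathbb N^p$. *Statement.* Let $\gamma,\gamma'$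 be retractions on $U$, let $u_0$ be a (classical) coordinate system on $U_0$, and put $u=\gamma^*(u_0)$. Then $u$ is the even part of a coordinate system $(u,\xi)$ on $U$ with associated retraction $\gamma$. Let $(u,\xi)$ be any such coordinate system, and let the derivations $\partial_{u_l}$ be taken with respect to it. Let $\omega$ be a Berezin density on $U$ (or a Berezin form on $U$, with $U_0$ oriented). Then $$\omega\bigl(\gamma'^*(u_0)-\gamma^*(u_0)\bigr)^i.\partial_u^i=0\quad\text{for all but finitely many } i\in\mathbb N^p .$$ If $\omega$ and $\omega\bigl(\gamma'^*(u_0)-\gamma^*(u_0)\bigr)^i.\partial_u^i$ for all $0\neq i\in\mathbb N^p$ are integrable with respect to $\gamma$, then $\omega$ is integrable with respect to $\gamma'$, and $$\int_{(U,\gamma')}\omega=\int_{(U,\gamma)}\omega+\sum_{0\ne i\in\mathbb N^p}\frac1{i!}\int_{(U,\gamma)}\omega\bigl(\gamma'^*(u_0)-\gamma^*(u_0)\bigr)^i.\partial_u^i .$$ Here $a^i=a_1^{i_1}\cdots a_p^{i_p}$ and $i!=i_1!\cdots i_p!$. -/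

import Mathlib

open CategoryTheory TopologicalSpace Opposite MeasureTheory
open scoped Manifold ContDiff

noncomputable section

namespace SuperInt

universe u

/-- The Euclidean model space `ℝ^p`. -/
abbrev E (p : ℕ) : Type := EuclideanSpace ℝ (Fin p)

/-- The algebra `C^∞(V)` of smooth real functions on an open subset `V` of a manifold. -/
abbrev Smooth {p : ℕ} {M₀ : Type u} [TopologicalSpace M₀] [ChartedSpace (E p) M₀]
    (V : Opens M₀) : Type u :=
  C^∞⟮𝓘(ℝ, E p), V; 𝓘(ℝ, ℝ), ℝ⟯

/-- Restriction of smooth functions to a smaller open subset. -/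
def smoothRes {p : ℕ} {M₀ : Type u} [TopologicalSpace M₀] [ChartedSpace (E p) M₀]
    {V W : Opens M₀} (h : V ≤ W) : Smooth (p := p) W →+* Smooth (p := p) V :=
  ContMDiffMap.restrictRingHom 𝓘(ℝ, E p) 𝓘(ℝ, ℝ) ℝ h

/-! ### Classical coordinate systems -/

section Classical

variable {p : ℕ} {M₀ : Type u} [TopologicalSpace M₀] [ChartedSpace (E p) M₀]

/-- A classical (smooth) coordinate system `u₀` on the open set `U`: a chart of the maximal smooth
atlas whose domain is exactly `U`. -/
structure ClassicalCoords (p : ℕ) {M₀ : Type u} [TopologicalSpace M₀] [ChartedSpace (E p) M₀]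
    (U : Opens M₀) where
  chart : OpenPartialHomeomorph M₀ (E p)
  mem_atlas : chart ∈ IsManifold.maximalAtlas 𝓘(ℝ, E p) ∞ M₀
  source_eq : chart.source = (U : Set M₀)

namespace ClassicalCoords

variable {U : Opens M₀}

lemma symm_mem (w : ClassicalCoords p U) {e : E p} (he : e ∈ w.chart.target) :
    w.chart.symm e ∈ U := by
  have h : w.chart.symm e ∈ w.chart.source := w.chart.map_target he
  rw [w.source_eq] at h
  exact h

lemma mem_source (w : ClassicalCoords p U) (m : U) : (m : M₀) ∈ w.chart.source := by
  rw [w.source_eq]; exact m.2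

lemma apply_mem (w : ClassicalCoords p U) (m : U) : w.chart m ∈ w.chart.target :=
  w.chart.map_source (w.mem_source m)

open Classical in
/-- The coordinate expression `h ∘ u₀⁻¹` of a function `h` on `U`; it lives on the open set
`u₀(U) ⊆ ℝ^p` and is extended by zero. -/
def pull (w : ClassicalCoords p U) (h : U → ℝ) : E p → ℝ := fun e =>
  if he : e ∈ w.chart.target then h ⟨w.chart.symm e, w.symm_mem he⟩ else 0

lemma pull_apply (w : ClassicalCoords p U) (h : U → ℝ) {e : E p} (he : e ∈ w.chart.target) :
    w.pull h e = h ⟨w.chart.symm e, w.symm_mem he⟩ := dif_pos he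

lemma contDiffOn_pull (w : ClassicalCoords p U) (g : Smooth (p := p) U) :
    ContDiffOn ℝ ∞ (w.pull g) w.chart.target := by
  rw [← contMDiffOn_iff_contDiffOn]
  intro e he
  have h1 : ContMDiffOn 𝓘(ℝ, E p) 𝓘(ℝ, E p) ∞ w.chart.symm w.chart.target :=
    contMDiffOn_symm_of_mem_maximalAtlas w.mem_atlas
  classical
  let G : M₀ → ℝ := fun m => if hm : m ∈ U then g ⟨m, hm⟩ else 0
  have hG : ContMDiffAt 𝓘(ℝ, E p) 𝓘(ℝ, ℝ) ∞ G (w.chart.symm e) := by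
    have : ContMDiffAt 𝓘(ℝ, E p) 𝓘(ℝ, ℝ) ∞ (fun x : U => G x) ⟨w.chart.symm e, w.symm_mem he⟩ := by
      have h2 : (fun x : U => G x) = g := by
        funext x; simp [G]
      rw [h2]; exact g.contMDiff _
    exact contMDiffAt_subtype_iff.mp this
  refine (hG.comp_contMDiffWithinAt e (h1 e he)).congr ?_ ?_
  · intro y hy
    simp [pull, G, hy, w.symm_mem hy]
  · simp [pull, G, he, w.symm_mem he]

/-- The `i`-th coordinate function `u_{0,i} ∈ C^∞(U)`. -/
def coord (w : ClassicalCoords p U) (i : Fin p) : Smooth (p := p) U :=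
  ⟨fun m => w.chart m i, by
    have h1 : ContMDiffOn 𝓘(ℝ, E p) 𝓘(ℝ, E p) ∞ w.chart w.chart.source :=
      contMDiffOn_of_mem_maximalAtlas w.mem_atlas
    have h2 : ContMDiff 𝓘(ℝ, E p) 𝓘(ℝ, E p) ∞ (fun m : U => w.chart m) :=
      h1.comp_contMDiff contMDiff_subtype_val (fun m => w.mem_source m)
    exact (EuclideanSpace.proj i : E p →L[ℝ] ℝ).contDiff.contMDiff.comp h2⟩

/-- The classical partial derivative `∂g/∂u_{0,i} ∈ C^∞(U)` of `g ∈ C^∞(U)`. -/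
def pderiv (w : ClassicalCoords p U) (i : Fin p) (g : Smooth (p := p) U) : Smooth (p := p) U :=
  ⟨fun m => fderiv ℝ (w.pull g) (w.chart m) (EuclideanSpace.single i 1), by
    have h1 : ContMDiffOn 𝓘(ℝ, E p) 𝓘(ℝ, E p) ∞ w.chart w.chart.source :=
      contMDiffOn_of_mem_maximalAtlas w.mem_atlas
    have h2 : ContMDiff 𝓘(ℝ, E p) 𝓘(ℝ, E p) ∞ (fun m : U => w.chart m) :=
      h1.comp_contMDiff contMDiff_subtype_val (fun m => w.mem_source m)
    have h3 : ContDiffOn ℝ ∞ (fun e => fderiv ℝ (w.pull g) e (EuclideanSpace.single i 1))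
        w.chart.target :=
      ((w.contDiffOn_pull g).fderiv_of_isOpen w.chart.open_target (by simp)).clm_apply
        contDiffOn_const
    exact h3.contMDiffOn.comp_contMDiff h2 (fun m => w.apply_mem m)⟩

/-- The classical Jacobian determinant `det(∂u_{0,k}/∂w_{0,i})` as a function on `U`. -/
def jac (u w : ClassicalCoords p U) (m : U) : ℝ :=
  Matrix.det (Matrix.of fun i k : Fin p => w.pderiv i (u.coord k) m)

lemma jac_ne_zero (u w : ClassicalCoords p U) (m : U) : u.jac w m ≠ 0 := by
  have hdiff : ∀ (a b : ClassicalCoords p U) (e : E p), e ∈ b.chart.target →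
      HasFDerivAt (fun e => a.chart (b.chart.symm e))
        (fderiv ℝ (fun e => a.chart (b.chart.symm e)) e) e := by
    intro a b e he
    refine DifferentiableAt.hasFDerivAt ?_
    rw [differentiableAt_euclidean]
    intro k
    have h1 : DifferentiableAt ℝ (b.pull (a.coord k)) e :=
      ((b.contDiffOn_pull (a.coord k)).contDiffAt (b.chart.open_target.mem_nhds he)
        ).differentiableAt (by simp)
    refine h1.congr_of_eventuallyEq ?_
    filter_upwards [b.chart.open_target.mem_nhds he] with y hy
    rw [b.pull_apply _ hy]; rfl
  set B := fderiv ℝ (fun e => u.chart (w.chart.symm e)) (w.chart m) with hB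
  set A := fderiv ℝ (fun e => w.chart (u.chart.symm e)) (u.chart m) with hA
  have h1 := hdiff u w (w.chart m) (w.apply_mem m)
  have h2 := hdiff w u (u.chart m) (u.apply_mem m)
  have hsw : w.chart.symm (w.chart m) = m := w.chart.left_inv (w.mem_source m)
  have h3 : HasFDerivAt (fun e => u.chart (w.chart.symm (w.chart (u.chart.symm e)))) (B.comp A)
      (u.chart m) := by
    have hsu : u.chart.symm (u.chart m) = m := u.chart.left_inv (u.mem_source m)
    have h1' : HasFDerivAt (fun e => u.chart (w.chart.symm e)) B
        ((fun e => w.chart (u.chart.symm e)) (u.chart m)) := by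
      simpa only [hsu] using h1
    exact h1'.comp (u.chart m) h2
  have h4 : HasFDerivAt (fun e => u.chart (w.chart.symm (w.chart (u.chart.symm e))))
      (ContinuousLinearMap.id ℝ (E p)) (u.chart m) := by
    refine (hasFDerivAt_id (u.chart m)).congr_of_eventuallyEq ?_
    filter_upwards [u.chart.open_target.mem_nhds (u.apply_mem m)] with e he
    rw [w.chart.left_inv (w.mem_source ⟨_, u.symm_mem he⟩), u.chart.right_inv he]; rfl
  have h5 : B.comp A = ContinuousLinearMap.id ℝ (E p) := h3.unique h4
  have h6 : (Matrix.of fun i k : Fin p => w.pderiv i (u.coord k) m) =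
      (LinearMap.toMatrix (EuclideanSpace.basisFun (Fin p) ℝ).toBasis
        (EuclideanSpace.basisFun (Fin p) ℝ).toBasis (B : E p →ₗ[ℝ] E p)).transpose := by
    ext i k
    have h7 : HasFDerivAt (w.pull (u.coord k))
        ((EuclideanSpace.proj k : E p →L[ℝ] ℝ).comp B) (w.chart m) := by
      refine (((EuclideanSpace.proj k : E p →L[ℝ] ℝ).hasFDerivAt).comp
        (w.chart m) h1).congr_of_eventuallyEq ?_
      filter_upwards [w.chart.open_target.mem_nhds (w.apply_mem m)] with y hy
      rw [w.pull_apply _ hy]; rfl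
    have h8 : w.pderiv i (u.coord k) m
        = fderiv ℝ (w.pull (u.coord k)) (w.chart m) (EuclideanSpace.single i 1) := rfl
    simp [LinearMap.toMatrix_apply, h8, h7.fderiv]
  have h9 : LinearMap.det (B : E p →ₗ[ℝ] E p) * LinearMap.det (A : E p →ₗ[ℝ] E p) = 1 := by
    rw [← LinearMap.det_comp]
    have : (B : E p →ₗ[ℝ] E p) ∘ₗ (A : E p →ₗ[ℝ] E p) = LinearMap.id := by
      ext1 v; exact congrArg (fun L : E p →L[ℝ] E p => L v) h5
    rw [this, LinearMap.det_id]
  intro h0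
  rw [jac, h6, Matrix.det_transpose, LinearMap.det_toMatrix] at h0
  rw [h0, zero_mul] at h9
  exact zero_ne_one h9

/-- The relative orientation `sgn det(∂u_{0,k}/∂w_{0,i})`, a smooth function with values `±1`. -/
def relSign (u w : ClassicalCoords p U) : Smooth (p := p) U :=
  ⟨fun m => (SignType.sign (u.jac w m) : ℝ), by
    have hc : Continuous (u.jac w) := by
      unfold jac
      refine Continuous.matrix_det (continuous_matrix fun i k => ?_)
      exact (w.pderiv i (u.coord k)).contMDiff.continuous
    intro m
    refine (contMDiffAt_const (c := (SignType.sign (u.jac w m) : ℝ))).congr_of_eventuallyEq ?_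
    rcases lt_or_gt_of_ne (u.jac_ne_zero w m) with h | h
    · filter_upwards [hc.continuousAt.eventually_lt continuousAt_const h] with x hx
      rw [sign_neg hx, sign_neg h]
    · filter_upwards [continuousAt_const.eventually_lt hc.continuousAt h] with x hx
      rw [sign_pos hx, sign_pos h]⟩

end ClassicalCoords

/-- An orientation of the manifold `U`: it says at each point of `U` whether a coordinate system is
positively (`1`) or negatively (`-1`) oriented there; this is locally constant and changes by the
sign of the Jacobian determinant. -/
structure Orientation (p : ℕ) {M₀ : Type u} [TopologicalSpace M₀] [ChartedSpace (E p) M₀]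
    (U : Opens M₀) where
  sign : ClassicalCoords p U → U → ℤˣ
  locConst : ∀ w, IsLocallyConstant (sign w)
  compat : ∀ (u w : ClassicalCoords p U) (m : U),
    ((sign u m : ℤ) : ℝ) = ((sign w m : ℤ) : ℝ) * u.relSign w m

/-- The two kinds of integrands: Berezin densities, or Berezin forms over an oriented base. -/
inductive Kind (p : ℕ) {M₀ : Type u} [TopologicalSpace M₀] [ChartedSpace (E p) M₀]
    (U : Opens M₀) : Type u
  | density : Kind p U
  | form (o : Orientation p U) : Kind p U

/-- A density `h_w |dw|`, resp. a top degree form `h_w dw`, on `U`, given by its coefficient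
functions `h_w : U → ℝ` in all coordinate systems `w`. -/
abbrev TopFamily (p : ℕ) {M₀ : Type u} [TopologicalSpace M₀] [ChartedSpace (E p) M₀]
    (U : Opens M₀) : Type u :=
  ClassicalCoords p U → U → ℝ

namespace Kind

variable {U : Opens M₀}

/-- The factor by which integrating `h dw` differs from integrating `h |dw|`: it is `1` for
densities, and `±1` according to the orientation of `w` for forms. -/
def weight (k : Kind p U) (w : ClassicalCoords p U) (m : U) : ℝ :=
  match k with
  | density => 1
  | form o => ((o.sign w m : ℤ) : ℝ)

/-- The density (or top degree form) `h` is integrable on `U`. -/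
def BaseIntegrable (k : Kind p U) (h : TopFamily p U) : Prop :=
  ∀ w : ClassicalCoords p U,
    IntegrableOn (w.pull fun m => k.weight w m * h w m) w.chart.target volume

open Classical in
/-- The integral over `U` of a density (or top degree form) `h`, computed in a coordinate system
on `U` with respect to Lebesgue measure on `ℝ^p`. -/
def baseIntegral (k : Kind p U) (h : TopFamily p U) : ℝ :=
  if hw : Nonempty (ClassicalCoords p U) then
    ∫ e in hw.some.chart.target,
      hw.some.pull (fun m => k.weight hw.some m * h hw.some m) e
  else 0

end Kind

end Classical

/-! ### Supermanifolds -/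

/-- A sheaf of supercommutative real superalgebras `O` on the manifold `M₀`, with the morphism
`j^* : O → C^∞` of sheaves of algebras belonging to the canonical embedding `j` of `M₀`. -/
structure SuperSpace (p : ℕ) (M₀ : Type u) [TopologicalSpace M₀] [ChartedSpace (E p) M₀] where
  sheaf : TopCat.Sheaf (AlgCat.{u} ℝ) (TopCat.of M₀)
  parity : ∀ V : Opens M₀, ZMod 2 → Submodule ℝ (sheaf.presheaf.obj (op V))
  graded : ∀ V, SetLike.GradedMonoid (parity V)
  internal : ∀ V, DirectSum.IsInternal (parity V)
  supercomm : ∀ V (a b : ZMod 2) (f g : sheaf.presheaf.obj (op V)),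
    f ∈ parity V a → g ∈ parity V b → f * g = (-1 : ℝ) ^ (a * b).val • (g * f)
  parity_res : ∀ {V W : Opens M₀} (h : V ≤ W) (a : ZMod 2) (f : sheaf.presheaf.obj (op W)),
    f ∈ parity W a → (sheaf.presheaf.map (homOfLE h).op).hom f ∈ parity V a
  body : ∀ V : Opens M₀, sheaf.presheaf.obj (op V) →ₐ[ℝ] Smooth (p := p) V
  body_res : ∀ {V W : Opens M₀} (h : V ≤ W) (f : sheaf.presheaf.obj (op W)),
    body V ((sheaf.presheaf.map (homOfLE h).op).hom f) = smoothRes h (body W f)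

section Super

variable {p q : ℕ} {M₀ : Type u} [TopologicalSpace M₀] [ChartedSpace (E p) M₀]

namespace SuperSpace

/-- The algebra `O(V)` of superfunctions on `V`. -/
abbrev sec (X : SuperSpace p M₀) (V : Opens M₀) : Type u := X.sheaf.presheaf.obj (op V)

/-- Restriction of superfunctions. -/
def res (X : SuperSpace p M₀) {V W : Opens M₀} (h : V ≤ W) : X.sec W →ₐ[ℝ] X.sec V :=
  (X.sheaf.presheaf.map (homOfLE h).op).hom

end SuperSpace

/-- A retraction `γ` on `U`, i.e. a morphism of superspaces from `U` to its underlying manifold with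
`γ ∘ j = id`. The latter forces the underlying map of `γ` to be the identity, so that `γ` consists
of a morphism `γ^* : C^∞ → O` of sheaves of superalgebras on `U` with `j^* ∘ γ^* = id`. -/
structure Retraction (X : SuperSpace p M₀) (U : Opens M₀) where
  pullback : ∀ V : Opens M₀, V ≤ U → Smooth (p := p) V →ₐ[ℝ] X.sec V
  even : ∀ V hV g, pullback V hV g ∈ X.parity V 0
  natural : ∀ {V W : Opens M₀} (h : V ≤ W) (hW : W ≤ U) (g : Smooth (p := p) W),
    X.res h (pullback W hW g) = pullback V (h.trans hW) (smoothRes h g)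
  body_pullback : ∀ V hV g, X.body V (pullback V hV g) = g

/-- The pullback `γ^* : C^∞(U) → O(U)` on global sections. -/
def Retraction.star {X : SuperSpace p M₀} {U : Opens M₀} (γ : Retraction X U) :
    Smooth (p := p) U →ₐ[ℝ] X.sec U :=
  γ.pullback U le_rfl

/-- The ordered monomial `ξ^ν = ξ_1^{ν_1} ⋯ ξ_q^{ν_q}` for `ν ∈ {0,1}^q`, where `ν` is identified
with the set of the indices `j` with `ν_j = 1`. -/
def oddMonomial {A : Type*} [Ring A] (ξ : Fin q → A) (ν : Finset (Fin q)) : A :=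
  (List.ofFn fun j => if j ∈ ν then ξ j else 1).prod

/-- A coordinate system `x = (u, ξ)` on `U` with `q` odd coordinates: it is given by a classical
coordinate system `u₀`, the associated retraction `γ` and odd superfunctions `ξ_j`, such that
locally and globally each superfunction is uniquely `∑_ν γ^*(f_ν) ξ^ν`. In other words, `u₀`, `γ`
and `ξ` identify `U` with the superdomain over `u₀(U) ⊆ ℝ^p` with `q` odd coordinates. The even
coordinates are `u = γ^*(u₀)`; they determine `u₀` and `γ`. -/
structure CoordSystem (q : ℕ) (X : SuperSpace p M₀) (U : Opens M₀) where
  coords : ClassicalCoords p U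
  retr : Retraction X U
  ξ : Fin q → X.sec U
  odd : ∀ j, ξ j ∈ X.parity U 1
  decomp : ∀ (V : Opens M₀) (hV : V ≤ U) (f : X.sec V),
    ∃! c : Finset (Fin q) → Smooth (p := p) V,
      f = ∑ ν, retr.pullback V hV (c ν) * oddMonomial (fun j => X.res hV (ξ j)) ν

/-- A supermanifold of dimension `(p, q)` over the manifold `M₀`: each point has a neighbourhood
with a coordinate system. -/
structure Supermanifold (p q : ℕ) (M₀ : Type u) [TopologicalSpace M₀] [ChartedSpace (E p) M₀]
    extends SuperSpace p M₀ where
  locallyTrivial : ∀ m : M₀, ∃ U : Opens M₀, m ∈ U ∧ Nonempty (CoordSystem q toSuperSpace U)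

/-- `U` is a coordinate neighbourhood. -/
def Supermanifold.IsCoordNhd (M : Supermanifold p q M₀) (U : Opens M₀) : Prop :=
  Nonempty (CoordSystem q M.toSuperSpace U)

namespace CoordSystem

variable {X : SuperSpace p M₀} {U : Opens M₀}

/-- The even coordinates `u_i = γ^*(u_{0,i})`. -/
def u (x : CoordSystem q X U) (i : Fin p) : X.sec U := x.retr.star (x.coords.coord i)

/-- The coefficients `f_ν` in `f = ∑_ν γ^*(f_ν) ξ^ν`. -/
def coeff (x : CoordSystem q X U) (f : X.sec U) : Finset (Fin q) → Smooth (p := p) U :=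
  Classical.choose (x.decomp U le_rfl f)

/-- The top coefficient `f_{(1,…,1)}`. -/
def top (x : CoordSystem q X U) (f : X.sec U) : Smooth (p := p) U := x.coeff f Finset.univ

/-- The derivation `∂/∂u_i`, i.e. `∂f/∂u_i = ∑_ν γ^*(∂f_ν/∂u_{0,i}) ξ^ν`. -/
def dEven (x : CoordSystem q X U) (i : Fin p) (f : X.sec U) : X.sec U :=
  ∑ ν : Finset (Fin q), x.retr.star (x.coords.pderiv i (x.coeff f ν)) * oddMonomial x.ξ ν

/-- The derivation `∂/∂ξ_j`, i.e.
`∂f/∂ξ_j = ∑_{ν, ν_j = 1} (-1)^{ν_1 + ⋯ + ν_{j-1}} γ^*(f_ν) ξ^{ν - e_j}`. -/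
def dOdd (x : CoordSystem q X U) (j : Fin q) (f : X.sec U) : X.sec U :=
  ∑ ν : Finset (Fin q) with j ∈ ν,
    (-1 : ℝ) ^ (ν.filter (· < j)).card • (x.retr.star (x.coeff f ν) * oddMonomial x.ξ (ν.erase j))

end CoordSystem

/-! ### Berezinians, Berezin densities and Berezin forms -/

/-- The determinant, by the Leibniz formula, of a matrix with (commuting) entries in a ring which
as a whole need not be commutative. -/
def leibnizDet {n : ℕ} {A : Type*} [Ring A] (N : Matrix (Fin n) (Fin n) A) : A :=
  ∑ σ : Equiv.Perm (Fin n), (Equiv.Perm.sign σ : ℤ) • (List.ofFn fun i => N (σ i) i).prod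

/-- The Berezinian `det(R - S V⁻¹ T) det V⁻¹` of the supermatrix with blocks `R`, `S`, `T`, `V`. -/
def berezinian {A : Type*} [Ring A] (R : Matrix (Fin p) (Fin p) A) (S : Matrix (Fin p) (Fin q) A)
    (T : Matrix (Fin q) (Fin p) A) (V : Matrix (Fin q) (Fin q) A) : A :=
  leibnizDet (R - S * Ring.inverse V * T) * leibnizDet (Ring.inverse V)

section Ber

variable {X : SuperSpace p M₀} {U : Opens M₀}

/-- The Berezinian `D x / D y` of the coordinate change from `x = (u, ξ)` to `y = (v, η)`; the rows
of the matrix are indexed by the coordinates `y`, the columns by `x`. -/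
def ber (x y : CoordSystem q X U) : X.sec U :=
  berezinian
    (Matrix.of fun (i k : Fin p) => y.dEven i (x.u k))
    (Matrix.of fun (i : Fin p) (k : Fin q) => y.dEven i (x.ξ k))
    (Matrix.of fun (i : Fin q) (k : Fin p) => y.dOdd i (x.u k))
    (Matrix.of fun (i k : Fin q) => y.dOdd i (x.ξ k))

/-- The factor in the transformation law: `|D| x / |D| y`, which is `± D x / D y` according to the
relative orientation of `u₀` and `v₀`, for densities, and `D x / D y` for forms. -/
def berFactor (k : Kind p U) (x y : CoordSystem q X U) : X.sec U :=
  match k with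
  | Kind.density => y.retr.star (x.coords.relSign y.coords) * ber x y
  | Kind.form _ => ber x y

/-- Assignments of a coefficient to each coordinate system on `U`. -/
abbrev BerFamily (q : ℕ) (X : SuperSpace p M₀) (U : Opens M₀) : Type u :=
  CoordSystem q X U → X.sec U

/-- A Berezin density (form) on the coordinate neighbourhood `U`: in each coordinate system `x` it
is `f_x |Dx|` (resp. `f_x Dx`), where `f_x |Dx| = f_x (|D| x / |D| y) |Dy|`. -/
def IsBerezin (k : Kind p U) (ϖ : BerFamily q X U) : Prop :=
  ∀ x y, ϖ y = ϖ x * berFactor k x y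

/-- The Berezin density `f |Dx|` (resp. form `f Dx`): its coefficient with respect to `y` is
`f (|D| x / |D| y)` (resp. `f (D x / D y)`). -/
def ofCoeff (k : Kind p U) (x : CoordSystem q X U) (f : X.sec U) : BerFamily q X U :=
  fun y => f * berFactor k x y

/-- The product `ϖ a` of `ϖ` with an even superfunction `a`. -/
def mulEven (ϖ : BerFamily q X U) (a : X.sec U) : BerFamily q X U := fun x => ϖ x * a

/-- The Lie derivative of `ϖ = f |Dx|` along `∂/∂u_i`, which is `(∂f/∂u_i) |Dx|`. -/
def lieDeriv (k : Kind p U) (x : CoordSystem q X U) (i : Fin p) (ϖ : BerFamily q X U) :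
    BerFamily q X U :=
  ofCoeff k x (x.dEven i (ϖ x))

/-- The right action `ϖ.(∂/∂u_i) = - L_{∂/∂u_i} ϖ` of the even vector field `∂/∂u_i`. -/
def act (k : Kind p U) (x : CoordSystem q X U) (i : Fin p) (ϖ : BerFamily q X U) :
    BerFamily q X U :=
  -lieDeriv k x i ϖ

/-- The right action `ϖ.∂_u^i` of `∂_u^i = ∂_{u_p}^{i_p} ∘ ⋯ ∘ ∂_{u_1}^{i_1}`; as it is a right
action, the leftmost factor acts first. -/
def actMulti (k : Kind p U) (x : CoordSystem q X U) (i : Fin p → ℕ) (ϖ : BerFamily q X U) :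
    BerFamily q X U :=
  (List.finRange p).foldr (fun l η => (act k x l)^[i l] η) ϖ

/-- The power `(γ'^*(u₀) - γ^*(u₀))^i = ∏_l (γ'^*(u_{0,l}) - γ^*(u_{0,l}))^{i_l}`. -/
def diffPow (γ γ' : Retraction X U) (u₀ : ClassicalCoords p U) (i : Fin p → ℕ) : X.sec U :=
  (List.ofFn fun l => (γ'.star (u₀.coord l) - γ.star (u₀.coord l)) ^ i l).prod

/-! ### The integral with respect to a retraction -/

open Classical in
/-- The fibre integral `γ_! ϖ`. If `ϖ = f |Dx|` (or `f Dx`) for a coordinate system `x = (u, ξ)`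
with associated retraction `γ`, then `γ_! ϖ = (-1)^s f_{(1,…,1)} |du₀|` (or `du₀`). The result does
not depend on the choice of the odd coordinates `ξ`. The sign `(-1)^s` is a normalisation. -/
def fibreIntegral (s : ℕ) (γ : Retraction X U) (ϖ : BerFamily q X U) : TopFamily p U := fun w =>
  if h : ∃ x : CoordSystem q X U, x.coords = w ∧ x.retr = γ then
    fun m => (-1 : ℝ) ^ s * (Classical.choose h).top (ϖ (Classical.choose h)) m
  else 0

/-- `ϖ` is integrable with respect to `γ`. -/
def IntegrableWrt (k : Kind p U) (s : ℕ) (γ : Retraction X U) (ϖ : BerFamily q X U) : Prop :=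
  k.BaseIntegrable (fibreIntegral s γ ϖ)

/-- The integral `∫_{(U,γ)} ϖ`, that is, the integral over `U` of `γ_! ϖ`. -/
def integralWrt (k : Kind p U) (s : ℕ) (γ : Retraction X U) (ϖ : BerFamily q X U) : ℝ :=
  k.baseIntegral (fibreIntegral s γ ϖ)

end Ber

end Super

end SuperInt

end

/-! The formula already holds before integration, as a pointwise identity on the base: `γ'_! ω = ∑_i
(1/i!) γ_!(ω (v - u)^i . ∂_u^i)` with `u = γ^*(u₀)` and `v = γ'^*(u₀)`. The sum is finite because `v
- u` has zero body and is therefore nilpotent. Integrability and the integral formula then follow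
from linearity alone; no integration by parts on the base is needed, and no boundary condition
enters.

Write `n = v - u` and `L f = ∑_i (1/i!) (-∂_u)^i (n^i f)`. This operator is the formal transpose of
the Taylor expansion `g(u) ↦ g(u + n)`. Three properties carry the proof. Transposing substitution
gives `L(γ'^*(a) c) = γ^*(a) L(c)`; it is checked on coordinates (`derLagrange_add_mul`) and
extended to all smooth `a` by Hadamard's lemma. Transposing the chain rule gives
`derLagrange_derivation`. Together with the Piola identity `sum_derivation_adjugate`, the latter
yields `L(det ∂v/∂u) = 1` (`derLagrange_det`).

Take coordinates `(u, ξ)` over `γ` and `(v, ξ)` over `γ'` with the same odd part. Their Berezinian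
is `det(∂u/∂v)`, the inverse of `det(∂v/∂u)`. Expanding `f det(∂u/∂v) = ∑_ν γ'^*(g_ν) ξ^ν` and
applying `L` to `f` gives `L f = ∑_ν γ^*(g_ν) ξ^ν`. Comparing top coefficients proves the pointwise
identity (`Frame.top_mul_leibnizDet`).

Two further facts are required. Odd coordinates remain odd coordinates for any other retraction
(`Frame.decomp_of_retraction`), so the second coordinate system exists. The fibre integral does not
depend on the odd coordinates (`Frame.top_mul_det_oddJacobian`), so the unspecified choice in its
definition can be evaluated; the argument is an odd Piola identity together with the fact that odd
derivatives have no top coefficient. -/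

noncomputable section

namespace SuperInt

universe u

/-! ### Superalgebras with a retraction and odd coordinates -/

section Algebra

variable {R A : Type*} [CommRing R] [Algebra ℝ R] [Ring A] [Algebra ℝ A] {q : ℕ}

/-- `𝒜` is the grading of a supercommutative real superalgebra. -/
structure IsSuperalgebra (𝒜 : ZMod 2 → Submodule ℝ A) : Prop where
  graded : SetLike.GradedMonoid 𝒜
  internal : DirectSum.IsInternal 𝒜
  supercomm : ∀ (a b : ZMod 2) (f g : A), f ∈ 𝒜 a → g ∈ 𝒜 b →
    f * g = (-1 : ℝ) ^ (a * b).val • (g * f)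

namespace IsSuperalgebra

variable {𝒜 : ZMod 2 → Submodule ℝ A} (h : IsSuperalgebra 𝒜)
include h

lemma isCompl : IsCompl (𝒜 0) (𝒜 1) := by
  refine (DirectSum.isInternal_submodule_iff_isCompl 𝒜 (i := 0) (j := 1) (by decide) ?_).1
    h.internal
  ext a
  fin_cases a
  · exact ⟨fun _ => Or.inl rfl, fun _ => trivial⟩
  · exact ⟨fun _ => Or.inr rfl, fun _ => trivial⟩

lemma exists_add (b : A) : ∃ b₀ ∈ 𝒜 0, ∃ b₁ ∈ 𝒜 1, b₀ + b₁ = b :=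
  Submodule.mem_sup.1 (h.isCompl.sup_eq_top ▸ Submodule.mem_top)

lemma eq_zero_of_mem {a : A} (h₀ : a ∈ 𝒜 0) (h₁ : a ∈ 𝒜 1) : a = 0 :=
  Submodule.disjoint_def.1 h.isCompl.disjoint a h₀ h₁

lemma even_comm {a : A} (ha : a ∈ 𝒜 0) (b : A) : a * b = b * a := by
  obtain ⟨b₀, h₀, b₁, h₁, rfl⟩ := h.exists_add b
  have e₀ := h.supercomm 0 0 a b₀ ha h₀
  have e₁ := h.supercomm 0 1 a b₁ ha h₁
  simp only [zero_mul, ZMod.val_zero, pow_zero, one_smul] at e₀ e₁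
  rw [mul_add, add_mul, e₀, e₁]

lemma odd_anticomm {a b : A} (ha : a ∈ 𝒜 1) (hb : b ∈ 𝒜 1) : a * b = -(b * a) := by
  have e := h.supercomm 1 1 a b ha hb
  simpa [ZMod.val_one] using e

lemma odd_sq {a : A} (ha : a ∈ 𝒜 1) : a * a = 0 := by
  have e := h.odd_anticomm ha ha
  have : (2 : ℝ) • (a * a) = 0 := by rw [two_smul]; nth_rewrite 1 [e]; simp
  simpa using this

lemma one_mem : (1 : A) ∈ 𝒜 0 := h.graded.one_mem

lemma mul_mem {a b : ZMod 2} {f g : A} (hf : f ∈ 𝒜 a) (hg : g ∈ 𝒜 b) : f * g ∈ 𝒜 (a + b) :=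
  h.graded.mul_mem hf hg

end IsSuperalgebra

/-- A presentation of a superalgebra as the exterior algebra with generators `ξ` over the image of
a homomorphism `γ` from a commutative algebra. -/
structure Frame (R : Type*) [CommRing R] [Algebra ℝ R] (𝒜 : ZMod 2 → Submodule ℝ A) (q : ℕ) where
  isSuper : IsSuperalgebra 𝒜
  γ : R →ₐ[ℝ] A
  ξ : Fin q → A
  even : ∀ g, γ g ∈ 𝒜 0
  odd : ∀ j, ξ j ∈ 𝒜 1
  decomp : ∀ f : A, ∃! c : Finset (Fin q) → R, f = ∑ ν, γ (c ν) * oddMonomial ξ ν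

/-! ### Signs and products of odd monomials -/

section Monomial

variable {𝒜 : ZMod 2 → Submodule ℝ A} (h : IsSuperalgebra 𝒜) {ξ : Fin q → A}
  (hξ : ∀ j, ξ j ∈ 𝒜 1)

omit [Algebra ℝ A] in
lemma oddMonomial_eq (ξ : Fin q → A) (ν : Finset (Fin q)) :
    oddMonomial ξ ν = ((List.finRange q).map fun j => if j ∈ ν then ξ j else 1).prod := by
  rw [oddMonomial, List.ofFn_eq_map]

omit [Algebra ℝ A] in
@[simp] lemma oddMonomial_empty (ξ : Fin q → A) : oddMonomial ξ ∅ = 1 := by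
  simp [oddMonomial_eq]

include h hξ

/-- Moving `ξ k` to its slot costs one sign for each smaller index in `ν`. An arbitrary increasing
list replaces `List.finRange q` so that induction applies: the factor at slot `k` is `1` before the
move and `ξ k` after it. -/
lemma mul_listMonomial {k : Fin q} {ν : Finset (Fin q)} (hk : k ∉ ν) (l : List (Fin q))
    (hl : l.Pairwise (· < ·)) (hkl : k ∈ l) :
    ξ k * (l.map fun j => if j ∈ ν then ξ j else 1).prod =
      (-1 : ℝ) ^ (l.countP fun j => j ∈ ν ∧ j < k) •
        (l.map fun j => if j ∈ insert k ν then ξ j else 1).prod := by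
  induction l with
  | nil => simp at hkl
  | cons a l ih =>
    rw [List.pairwise_cons] at hl
    by_cases hak : a = k
    · subst hak
      have h1 : l.countP (fun j => j ∈ ν ∧ j < a) = 0 := by
        rw [List.countP_eq_zero]
        intro j hj
        simp [(hl.1 j hj).le]
      have h2 : (l.map fun j => if j ∈ insert a ν then ξ j else 1) =
          l.map fun j => if j ∈ ν then ξ j else 1 := by
        refine List.map_congr_left fun j hj => ?_
        simp [(hl.1 j hj).ne']
      rw [List.countP_cons, h1, List.map_cons, List.map_cons, h2]
      simp [hk]
    · have hkl' : k ∈ l := by simpa [Ne.symm hak] using hkl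
      have hlt : a < k := hl.1 k hkl'
      have ih' := ih hl.2 hkl'
      rw [List.countP_cons, List.map_cons, List.map_cons, List.prod_cons, List.prod_cons]
      by_cases ha : a ∈ ν
      · simp only [ha, hlt, if_true, Finset.mem_insert, or_true, and_self, decide_true]
        rw [← mul_assoc, h.odd_anticomm (hξ k) (hξ a), neg_mul, mul_assoc, ih', pow_succ]
        simp
      · simpa only [ha, hak, if_false, Finset.mem_insert, or_self, false_and, decide_false,
          Bool.false_eq_true, add_zero, one_mul] using ih'

lemma mul_oddMonomial {k : Fin q} {ν : Finset (Fin q)} (hk : k ∉ ν) :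
    ξ k * oddMonomial ξ ν =
      (-1 : ℝ) ^ (ν.filter (· < k)).card • oddMonomial ξ (insert k ν) := by
  rw [oddMonomial_eq, oddMonomial_eq,
    mul_listMonomial h hξ hk _ (List.pairwise_lt_finRange q) (List.mem_finRange k)]
  congr 2
  rw [List.countP_eq_length_filter,
    ← List.toFinset_card_of_nodup ((List.nodup_finRange q).filter _)]
  congr 1
  ext j
  simp

lemma oddMonomial_insert {k : Fin q} {ν : Finset (Fin q)} (hk : k ∉ ν) :
    oddMonomial ξ (insert k ν) =
      (-1 : ℝ) ^ (ν.filter (· < k)).card • (ξ k * oddMonomial ξ ν) := by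
  rw [mul_oddMonomial h hξ hk, smul_smul, ← pow_add, Even.neg_one_pow ⟨_, rfl⟩, one_smul]

lemma mul_oddMonomial_of_mem {k : Fin q} {ν : Finset (Fin q)} (hk : k ∈ ν) :
    ξ k * oddMonomial ξ ν = 0 := by
  rw [← Finset.insert_erase hk, oddMonomial_insert h hξ (Finset.notMem_erase k ν),
    mul_smul_comm, ← mul_assoc, h.odd_sq (hξ k), zero_mul, smul_zero]

lemma oddMonomial_mul (μ ν : Finset (Fin q)) : ∃ s : ℝ,
    oddMonomial ξ μ * oddMonomial ξ ν = s • oddMonomial ξ (μ ∪ ν) ∧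
      (¬ Disjoint μ ν → s = 0) := by
  induction μ using Finset.induction_on with
  | empty => exact ⟨1, by simp, by simp⟩
  | insert k μ hk ih =>
    obtain ⟨s, hs, hs0⟩ := ih
    rw [oddMonomial_insert h hξ hk, smul_mul_assoc, mul_assoc, hs, mul_smul_comm]
    by_cases hkμ : k ∈ μ ∪ ν
    · exact ⟨0, by rw [mul_oddMonomial_of_mem h hξ hkμ]; simp, fun _ => rfl⟩
    · refine ⟨_, by rw [mul_oddMonomial h hξ hkμ, smul_smul, smul_smul, Finset.insert_union], ?_⟩
      intro hd
      have hkν : k ∉ ν := fun hh => hkμ (Finset.mem_union_right _ hh)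
      rw [hs0 (fun hd' => hd (by rw [Finset.disjoint_insert_left]; exact ⟨hkν, hd'⟩))]
      simp

lemma oddMonomial_mem (ν : Finset (Fin q)) : oddMonomial ξ ν ∈ 𝒜 (ν.card : ZMod 2) := by
  induction ν using Finset.induction_on with
  | empty => simpa using h.one_mem
  | insert k ν hk ih =>
    rw [oddMonomial_insert h hξ hk, Finset.card_insert_of_notMem hk]
    refine Submodule.smul_mem _ _ ?_
    have := h.mul_mem (hξ k) ih
    rwa [Nat.cast_add, Nat.cast_one, add_comm]

end Monomial

/-! ### Coefficients and the filtration by odd degree -/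

namespace Frame

variable {𝒜 : ZMod 2 → Submodule ℝ A} (F : Frame R 𝒜 q)

lemma γ_comm (g : R) (b : A) : F.γ g * b = b * F.γ g := F.isSuper.even_comm (F.even g) b

/-- The superfunction with given coefficients. -/
def ofCoeffs : (Finset (Fin q) → R) →ₗ[ℝ] A where
  toFun c := ∑ ν, F.γ (c ν) * oddMonomial F.ξ ν
  map_add' c d := by simp [add_mul, Finset.sum_add_distrib]
  map_smul' r c := by simp [Finset.smul_sum]

lemma ofCoeffs_apply (c : Finset (Fin q) → R) :
    F.ofCoeffs c = ∑ ν, F.γ (c ν) * oddMonomial F.ξ ν := rfl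

lemma ofCoeffs_bijective : Function.Bijective F.ofCoeffs := by
  constructor
  · intro c d hcd
    exact (F.decomp (F.ofCoeffs c)).unique rfl hcd
  · intro f
    obtain ⟨c, hc, -⟩ := F.decomp f
    exact ⟨c, hc.symm⟩

/-- Superfunctions and their coefficients. -/
def coeffEquiv : (Finset (Fin q) → R) ≃ₗ[ℝ] A :=
  LinearEquiv.ofBijective F.ofCoeffs F.ofCoeffs_bijective

/-- The coefficients of a superfunction. -/
def coeff : A →ₗ[ℝ] (Finset (Fin q) → R) := F.coeffEquiv.symm.toLinearMap

@[simp] lemma ofCoeffs_coeff (f : A) : F.ofCoeffs (F.coeff f) = f :=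
  F.coeffEquiv.apply_symm_apply f

@[simp] lemma coeff_ofCoeffs (c : Finset (Fin q) → R) : F.coeff (F.ofCoeffs c) = c :=
  F.coeffEquiv.symm_apply_apply c

lemma sum_coeff (f : A) : f = ∑ ν, F.γ (F.coeff f ν) * oddMonomial F.ξ ν :=
  (F.ofCoeffs_coeff f).symm

lemma coeff_injective {f g : A} (h : ∀ ν, F.coeff f ν = F.coeff g ν) : f = g := by
  rw [← F.ofCoeffs_coeff f, ← F.ofCoeffs_coeff g, funext h]

lemma ofCoeffs_single (ν : Finset (Fin q)) (a : R) :
    F.ofCoeffs (Pi.single ν a) = F.γ a * oddMonomial F.ξ ν := by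
  rw [ofCoeffs_apply, Finset.sum_eq_single ν]
  · simp
  · intro μ _ hμ
    simp [hμ]
  · simp

lemma coeff_γ_mul_X (a : R) (ν : Finset (Fin q)) :
    F.coeff (F.γ a * oddMonomial F.ξ ν) = Pi.single ν a := by
  rw [← ofCoeffs_single, coeff_ofCoeffs]

lemma coeff_X (ν : Finset (Fin q)) : F.coeff (oddMonomial F.ξ ν) = Pi.single ν 1 := by
  have := F.coeff_γ_mul_X 1 ν
  rwa [map_one, one_mul] at this

lemma coeff_γ_mul (a : R) (f : A) (ν : Finset (Fin q)) :
    F.coeff (F.γ a * f) ν = a * F.coeff f ν := by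
  have : F.γ a * f = F.ofCoeffs (fun ν => a * F.coeff f ν) := by
    conv_lhs => rw [F.sum_coeff f]
    simp [ofCoeffs_apply, Finset.mul_sum, mul_assoc]
  rw [this, coeff_ofCoeffs]

/-- Superfunctions are sums of terms `γ(a) ξ^ν`. -/
lemma induction {P : A → Prop} (hadd : ∀ f g, P f → P g → P (f + g))
    (hmon : ∀ a ν, P (F.γ a * oddMonomial F.ξ ν)) (f : A) : P f := by
  rw [F.sum_coeff f]
  have h0 : P 0 := by simpa using hmon 0 ∅
  exact Finset.sum_induction _ P hadd h0 fun ν _ => hmon _ _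

/-- The superfunctions of degree at least `k` in the odd coordinates. -/
def filt (k : ℕ) : Submodule ℝ A where
  carrier := {f | ∀ μ : Finset (Fin q), μ.card < k → F.coeff f μ = 0}
  add_mem' hf hg μ hμ := by simp [hf μ hμ, hg μ hμ]
  zero_mem' μ _ := by simp
  smul_mem' r f hf μ hμ := by simp [hf μ hμ]

lemma γ_mul_X_mem_filt {k : ℕ} (a : R) {ν : Finset (Fin q)} (h : k ≤ ν.card) :
    F.γ a * oddMonomial F.ξ ν ∈ F.filt k := by
  intro μ hμ
  rw [coeff_γ_mul_X, Pi.single_eq_of_ne]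
  rintro rfl
  omega

/-- Monomials with disjoint index sets add their degrees, and those with a common index multiply to
zero. -/
lemma mul_mem_filt {j k : ℕ} {f g : A} (hf : f ∈ F.filt j) (hg : g ∈ F.filt k) :
    f * g ∈ F.filt (j + k) := by
  rw [F.sum_coeff f, F.sum_coeff g, Finset.sum_mul_sum]
  refine Submodule.sum_mem _ fun μ _ => Submodule.sum_mem _ fun ν _ => ?_
  by_cases hμ : μ.card < j
  · simp [hf μ hμ]
  by_cases hν : ν.card < k
  · simp [hg ν hν]
  have e : F.γ (F.coeff f μ) * oddMonomial F.ξ μ * (F.γ (F.coeff g ν) * oddMonomial F.ξ ν) =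
      F.γ (F.coeff f μ * F.coeff g ν) * (oddMonomial F.ξ μ * oddMonomial F.ξ ν) := by
    rw [mul_assoc, ← mul_assoc (oddMonomial F.ξ μ), ← F.γ_comm _ (oddMonomial F.ξ μ), map_mul]
    simp only [mul_assoc]
  obtain ⟨s, hs, hs0⟩ := oddMonomial_mul F.isSuper F.odd μ ν
  rw [e, hs]
  by_cases hd : Disjoint μ ν
  · rw [mul_smul_comm]
    refine Submodule.smul_mem _ _ (F.γ_mul_X_mem_filt _ ?_)
    rw [Finset.card_union_of_disjoint hd]
    omega
  · simp [hs0 hd]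

lemma pow_mem_filt {f : A} (hf : f ∈ F.filt 1) (k : ℕ) : f ^ k ∈ F.filt k := by
  induction k with
  | zero => intro μ hμ; omega
  | succ k ih => rw [pow_succ]; exact F.mul_mem_filt ih hf

lemma eq_zero_of_mem_filt {k : ℕ} (hk : q < k) {f : A} (hf : f ∈ F.filt k) : f = 0 := by
  refine F.coeff_injective fun ν => ?_
  rw [hf ν (lt_of_le_of_lt (by simpa using Finset.card_le_univ ν) hk)]
  simp

lemma pow_eq_zero {f : A} (hf : f ∈ F.filt 1) {k : ℕ} (hk : q < k) : f ^ k = 0 :=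
  F.eq_zero_of_mem_filt hk (F.pow_mem_filt hf k)

/-! ### The body map and change of retraction -/

section Body

variable [IsReduced R] {β : A →ₐ[ℝ] R} (hβ : ∀ a, β (F.γ a) = a)
include hβ

/-- Each `ξ j` squares to zero, so its image in the reduced ring `R` vanishes; only the constant
term survives. -/
lemma body_eq (f : A) : β f = F.coeff f ∅ := by
  have hξ : ∀ j, β (F.ξ j) = 0 := fun j => by
    have := congrArg β (F.isSuper.odd_sq (F.odd j))
    rw [map_mul, map_zero] at this
    exact eq_zero_of_pow_eq_zero (n := 2) (by rw [pow_two, this])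
  refine F.induction (P := fun f => β f = F.coeff f ∅) ?_ ?_ f
  · intro f g hf hg
    simp [hf, hg]
  · intro a ν
    rw [coeff_γ_mul_X, map_mul, hβ]
    rcases ν.eq_empty_or_nonempty with rfl | ⟨k, hk⟩
    · simp
    · rw [← Finset.insert_erase hk,
        oddMonomial_insert F.isSuper F.odd (Finset.notMem_erase k ν), map_smul, map_mul, hξ,
        Pi.single_eq_of_ne (Finset.insert_ne_empty _ _).symm]
      simp

lemma mem_filt_one_iff {f : A} : f ∈ F.filt 1 ↔ β f = 0 := by
  rw [F.body_eq hβ]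
  constructor
  · intro h
    exact h ∅ (by simp)
  · intro h μ hμ
    have : μ = ∅ := by simpa using hμ
    rw [this, h]

/-- The odd coordinates of a frame form a frame with any other retraction. -/
lemma decomp_of_retraction (γ' : R →ₐ[ℝ] A) (hβ' : ∀ a, β (γ' a) = a) (f : A) :
    ∃! c : Finset (Fin q) → R, f = ∑ ν, γ' (c ν) * oddMonomial F.ξ ν := by
  let T : (Finset (Fin q) → R) →ₗ[ℝ] A :=
    { toFun := fun c => ∑ ν, γ' (c ν) * oddMonomial F.ξ ν
      map_add' := fun c d => by simp [add_mul, Finset.sum_add_distrib]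
      map_smul' := fun r c => by simp [Finset.smul_sum] }
  -- The two retractions differ by elements of zero body, so `T` and `F.ofCoeffs` differ by terms of
  -- strictly higher odd degree. Hence `N` is nilpotent, and `T = F.ofCoeffs ∘ (1 + N)` is
  -- bijective.
  let N : Module.End ℝ (Finset (Fin q) → R) := F.coeff ∘ₗ (T - F.ofCoeffs)
  have hN : ∀ k c, (∀ μ : Finset (Fin q), μ.card < k → c μ = 0) →
      ∀ μ : Finset (Fin q), μ.card < k + 1 → N c μ = 0 := by
    intro k c hc
    change (T - F.ofCoeffs) c ∈ F.filt (k + 1)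
    have : (T - F.ofCoeffs) c = ∑ ν, (γ' (c ν) - F.γ (c ν)) * oddMonomial F.ξ ν := by
      simp [T, ofCoeffs_apply, sub_mul]
    rw [this]
    refine Submodule.sum_mem _ fun ν _ => ?_
    by_cases hν : ν.card < k
    · simp [hc ν hν]
    · rw [add_comm]
      refine F.mul_mem_filt ((F.mem_filt_one_iff hβ).2 (by simp [hβ, hβ'])) ?_
      have := F.γ_mul_X_mem_filt (k := k) 1 (not_lt.1 hν)
      rwa [map_one, one_mul] at this
  have hNk : ∀ k c, ∀ μ : Finset (Fin q), μ.card < k → (N ^ k) c μ = 0 := by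
    intro k
    induction k with
    | zero => intro c μ hμ; omega
    | succ k ih =>
      intro c
      rw [pow_succ', Module.End.mul_apply]
      exact hN k _ (ih c)
  have hnil : IsNilpotent N := ⟨q + 1, by
    refine LinearMap.ext fun c => funext fun ν => ?_
    exact hNk (q + 1) c ν (Nat.lt_succ_of_le (by simpa using Finset.card_le_univ ν))⟩
  have hT : T = F.ofCoeffs ∘ₗ (1 + N) := by
    refine LinearMap.ext fun c => ?_
    simp only [LinearMap.comp_apply, LinearMap.add_apply, Module.End.one_apply, map_add, N,
      LinearMap.sub_apply, ofCoeffs_coeff]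
    abel
  have hbij : Function.Bijective T := by
    rw [hT]
    exact F.ofCoeffs_bijective.comp ((Module.End.isUnit_iff _).1 hnil.isUnit_one_add)
  obtain ⟨c, hc⟩ := hbij.2 f
  exact ⟨c, hc.symm, fun d hd => hbij.1 ((hd.symm.trans hc.symm : T d = T c))⟩

end Body

end Frame

end Algebra

/-! ### Partial derivatives with respect to a frame -/

namespace Frame

variable {R A : Type*} [CommRing R] [Algebra ℝ R] [Ring A] [Algebra ℝ A] {q : ℕ}
  {𝒜 : ZMod 2 → Submodule ℝ A} (F : Frame R 𝒜 q)

/-- Superfunctions are generated by the functions and the odd coordinates. -/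
lemma induction_mul {P : A → Prop} (hadd : ∀ f g, P f → P g → P (f + g))
    (hγ : ∀ a, P (F.γ a)) (hξ : ∀ k f, P f → P (F.ξ k * f)) (f : A) : P f := by
  refine F.induction hadd ?_ f
  intro a ν
  induction ν using Finset.induction_on generalizing a with
  | empty => simpa using hγ a
  | insert k ν hk ih =>
    have : F.γ a * oddMonomial F.ξ (insert k ν) =
        F.ξ k * (F.γ ((-1 : ℝ) ^ (ν.filter (· < k)).card • a) * oddMonomial F.ξ ν) := by
      rw [oddMonomial_insert F.isSuper F.odd hk, ← mul_assoc, ← F.γ_comm, mul_assoc, map_smul,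
        smul_mul_assoc, mul_smul_comm]
    rw [this]
    exact hξ k _ (ih _)

lemma γ_mul_monomial_mem (a : R) (ν : Finset (Fin q)) :
    F.γ a * oddMonomial F.ξ ν ∈ 𝒜 (ν.card : ZMod 2) := by
  have := F.isSuper.mul_mem (F.even a) (oddMonomial_mem F.isSuper F.odd ν)
  rwa [zero_add] at this

/-- The sum `f₁` of the terms of the wrong parity has parity `a + 1` termwise, and parity `a` as the
difference of `f` and the remaining terms. Being of both parities, it vanishes, and so do its
coefficients. -/
lemma coeff_eq_zero_of_mem {a : ZMod 2} {f : A} (hf : f ∈ 𝒜 a) {ν : Finset (Fin q)}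
    (hν : (ν.card : ZMod 2) ≠ a) : F.coeff f ν = 0 := by
  have hz : ∀ a b : ZMod 2, b ≠ a → b = a + 1 := by decide
  set f₁ := ∑ μ with (μ.card : ZMod 2) ≠ a, F.γ (F.coeff f μ) * oddMonomial F.ξ μ with hf₁
  have h₁ : f₁ ∈ 𝒜 (a + 1) := Submodule.sum_mem _ fun μ hμ => by
    rw [← hz a _ (Finset.mem_filter.1 hμ).2]
    exact F.γ_mul_monomial_mem _ _
  have h₂ : f₁ ∈ 𝒜 a := by
    have e : f₁ = f - ∑ μ with (μ.card : ZMod 2) = a, F.γ (F.coeff f μ) * oddMonomial F.ξ μ := by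
      conv_rhs => enter [1]; rw [F.sum_coeff f]
      rw [hf₁, ← Finset.sum_filter_add_sum_filter_not Finset.univ (fun μ => (μ.card : ZMod 2) = a)]
      abel
    rw [e]
    refine Submodule.sub_mem _ hf (Submodule.sum_mem _ fun μ hμ => ?_)
    have := F.γ_mul_monomial_mem (F.coeff f μ) μ
    rwa [(Finset.mem_filter.1 hμ).2] at this
  have h₃ : f₁ = 0 := by
    have hcase : ∀ a : ZMod 2, a = 0 ∨ a = 1 := by decide
    rcases hcase a with rfl | rfl
    · exact F.isSuper.eq_zero_of_mem h₂ (by simpa using h₁)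
    · exact F.isSuper.eq_zero_of_mem (by simpa [show (1 + 1 : ZMod 2) = 0 from rfl] using h₁) h₂
  have h₄ : f₁ = F.ofCoeffs fun μ => if (μ.card : ZMod 2) ≠ a then F.coeff f μ else 0 := by
    rw [hf₁, ofCoeffs_apply, Finset.sum_filter]
    refine Finset.sum_congr rfl fun μ _ => ?_
    split_ifs <;> simp
  have h₅ := congrFun (congrArg F.coeff (h₃.symm.trans h₄)) ν
  rw [coeff_ofCoeffs, if_pos hν] at h₅
  simpa using h₅.symm

/-- An additive property of the superfunctions of parity `a` has to be checked on monomials only. -/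
lemma induction_of_mem {P : A → Prop} (hadd : ∀ f g, P f → P g → P (f + g)) {a : ZMod 2}
    (hmon : ∀ g ν, (ν.card : ZMod 2) = a → P (F.γ g * oddMonomial F.ξ ν)) (h0 : P 0) {f : A}
    (hf : f ∈ 𝒜 a) : P f := by
  rw [F.sum_coeff f]
  refine Finset.sum_induction _ P hadd h0 fun ν _ => ?_
  by_cases hν : (ν.card : ZMod 2) = a
  · exact hmon _ _ hν
  · simpa [F.coeff_eq_zero_of_mem hf hν] using h0

/-- The even derivation which extends `δ` and kills the odd coordinates. -/
def dEven (δ : Derivation ℝ R R) : A →ₗ[ℝ] A :=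
  F.ofCoeffs ∘ₗ (LinearMap.pi fun ν => δ.toLinearMap ∘ₗ LinearMap.proj ν) ∘ₗ F.coeff

/-! ### Even partial derivatives -/

section dEven

variable (δ : Derivation ℝ R R)

lemma dEven_eq (f : A) :
    F.dEven δ f = ∑ ν, F.γ (δ (F.coeff f ν)) * oddMonomial F.ξ ν := rfl

@[simp] lemma coeff_dEven (f : A) (ν : Finset (Fin q)) :
    F.coeff (F.dEven δ f) ν = δ (F.coeff f ν) := by
  change F.coeff (F.ofCoeffs _) ν = _
  rw [coeff_ofCoeffs]
  rfl

lemma dEven_γ_mul_monomial (a : R) (ν : Finset (Fin q)) :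
    F.dEven δ (F.γ a * oddMonomial F.ξ ν) = F.γ (δ a) * oddMonomial F.ξ ν := by
  refine F.coeff_injective fun μ => ?_
  rw [coeff_dEven, coeff_γ_mul_X, coeff_γ_mul_X]
  by_cases h : μ = ν
  · subst h; simp
  · simp [h]

@[simp] lemma dEven_γ (a : R) : F.dEven δ (F.γ a) = F.γ (δ a) := by
  simpa using F.dEven_γ_mul_monomial δ a ∅

@[simp] lemma dEven_monomial (ν : Finset (Fin q)) : F.dEven δ (oddMonomial F.ξ ν) = 0 := by
  simpa using F.dEven_γ_mul_monomial δ 1 ν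

lemma monomial_singleton (j : Fin q) : oddMonomial F.ξ {j} = F.ξ j := by
  have := oddMonomial_insert F.isSuper F.odd (Finset.notMem_empty j)
  simpa using this

@[simp] lemma dEven_ξ (j : Fin q) : F.dEven δ (F.ξ j) = 0 := by
  rw [← monomial_singleton, dEven_monomial]

/-- By additivity only terms `γ(a) ξ^μ` matter. A product of monomials is a real multiple of a
monomial, which behaves as a constant, so the Leibniz rule of `δ` is all that remains. -/
lemma dEven_mul (f g : A) : F.dEven δ (f * g) = F.dEven δ f * g + f * F.dEven δ g := by
  revert g
  refine F.induction (P := fun f => ∀ g, F.dEven δ (f * g) = F.dEven δ f * g + f * F.dEven δ g)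
    ?_ ?_ f
  · intro f₁ f₂ h₁ h₂ g
    simp only [add_mul, map_add, h₁, h₂]
    abel
  · intro a μ g
    refine F.induction (P := fun g => F.dEven δ (F.γ a * oddMonomial F.ξ μ * g) =
      F.dEven δ (F.γ a * oddMonomial F.ξ μ) * g + F.γ a * oddMonomial F.ξ μ * F.dEven δ g) ?_ ?_ g
    · intro g₁ g₂ h₁ h₂
      simp only [mul_add, map_add, h₁, h₂]
      abel
    · intro b ν
      have e : ∀ a b, F.γ a * oddMonomial F.ξ μ * (F.γ b * oddMonomial F.ξ ν) =
          F.γ (a * b) * (oddMonomial F.ξ μ * oddMonomial F.ξ ν) := by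
        intro a b
        rw [mul_assoc, ← mul_assoc (oddMonomial F.ξ μ), ← F.γ_comm _ (oddMonomial F.ξ μ), map_mul]
        simp only [mul_assoc]
      obtain ⟨s, hs, -⟩ := oddMonomial_mul F.isSuper F.odd μ ν
      rw [dEven_γ_mul_monomial, dEven_γ_mul_monomial, e, e, e, hs, ← add_mul, ← map_add,
        mul_smul_comm, mul_smul_comm, map_smul, dEven_γ_mul_monomial, Derivation.leibniz]
      simp only [smul_eq_mul, mul_comm b, add_comm]

lemma dEven_mem {a : ZMod 2} {f : A} (hf : f ∈ 𝒜 a) : F.dEven δ f ∈ 𝒜 a := by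
  refine F.induction_of_mem (P := fun f => F.dEven δ f ∈ 𝒜 a) ?_ ?_ ?_ hf
  · intro f g hf hg
    rw [map_add]
    exact Submodule.add_mem _ hf hg
  · intro g ν hν
    rw [dEven_γ_mul_monomial, ← hν]
    exact F.γ_mul_monomial_mem _ _
  · simp

lemma dEven_comm {δ δ' : Derivation ℝ R R} (h : ∀ a, δ (δ' a) = δ' (δ a)) (f : A) :
    F.dEven δ (F.dEven δ' f) = F.dEven δ' (F.dEven δ f) :=
  F.coeff_injective fun ν => by simp [h]

end dEven

/-- The odd derivation `∂/∂ξ_j`. -/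
def dOdd (j : Fin q) : A →ₗ[ℝ] A where
  toFun f := ∑ ν : Finset (Fin q) with j ∈ ν,
    (-1 : ℝ) ^ (ν.filter (· < j)).card • (F.γ (F.coeff f ν) * oddMonomial F.ξ (ν.erase j))
  map_add' f g := by simp [add_mul, Finset.sum_add_distrib]
  map_smul' r f := by
    rw [RingHom.id_apply, Finset.smul_sum]
    refine Finset.sum_congr rfl fun ν _ => ?_
    rw [map_smul, Pi.smul_apply, map_smul, smul_mul_assoc, smul_comm]

/-! ### Odd partial derivatives and the top coefficient -/

section dOdd

variable (j : Fin q)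

lemma dOdd_eq (f : A) : F.dOdd j f = ∑ ν : Finset (Fin q) with j ∈ ν,
    (-1 : ℝ) ^ (ν.filter (· < j)).card • (F.γ (F.coeff f ν) * oddMonomial F.ξ (ν.erase j)) := rfl

lemma dOdd_γ_mul (a : R) (f : A) : F.dOdd j (F.γ a * f) = F.γ a * F.dOdd j f := by
  simp only [dOdd_eq, coeff_γ_mul, map_mul, mul_assoc, Finset.mul_sum, mul_smul_comm]

lemma dOdd_monomial_of_mem {ν : Finset (Fin q)} (h : j ∈ ν) : F.dOdd j (oddMonomial F.ξ ν) =
    (-1 : ℝ) ^ (ν.filter (· < j)).card • oddMonomial F.ξ (ν.erase j) := by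
  rw [dOdd_eq, Finset.sum_eq_single ν]
  · simp [coeff_X]
  · intro μ _ hμ
    simp [coeff_X, hμ]
  · intro hν
    simp [h] at hν

lemma dOdd_monomial_of_notMem {ν : Finset (Fin q)} (h : j ∉ ν) :
    F.dOdd j (oddMonomial F.ξ ν) = 0 := by
  rw [dOdd_eq]
  refine Finset.sum_eq_zero fun μ hμ => ?_
  have : μ ≠ ν := by
    rintro rfl
    exact h (Finset.mem_filter.1 hμ).2
  simp [coeff_X, this]

@[simp] lemma dOdd_γ (a : R) : F.dOdd j (F.γ a) = 0 := by
  have := F.dOdd_γ_mul j a 1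
  rw [← oddMonomial_empty F.ξ, dOdd_monomial_of_notMem F j (Finset.notMem_empty j)] at this
  simpa using this

/-- This is the Clifford-type relation `∂_j ξ_k + ξ_k ∂_j = δ_{jk}` on monomials. The Leibniz rules
and the anticommutation of odd derivatives are derived from it. -/
lemma dOdd_ξ_mul_monomial (k : Fin q) (ν : Finset (Fin q)) :
    F.dOdd j (F.ξ k * oddMonomial F.ξ ν) =
      (if j = k then oddMonomial F.ξ ν else 0) - F.ξ k * F.dOdd j (oddMonomial F.ξ ν) := by
  have hs := F.isSuper
  by_cases hk : k ∈ ν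
  · rw [mul_oddMonomial_of_mem hs F.odd hk, map_zero]
    by_cases hjk : j = k
    · subst hjk
      rw [if_pos rfl, dOdd_monomial_of_mem F j hk, mul_smul_comm,
        mul_oddMonomial hs F.odd (Finset.notMem_erase j ν), Finset.insert_erase hk, smul_smul,
        ← pow_add, Even.neg_one_pow, one_smul, sub_self]
      rw [Finset.filter_erase, Finset.erase_eq_of_notMem (by simp)]
      exact ⟨_, rfl⟩
    · rw [if_neg hjk, zero_sub, eq_comm, neg_eq_zero]
      by_cases hj : j ∈ ν
      · rw [dOdd_monomial_of_mem F j hj, mul_smul_comm, mul_oddMonomial_of_mem hs F.odd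
          (Finset.mem_erase.2 ⟨Ne.symm hjk, hk⟩), smul_zero]
      · rw [dOdd_monomial_of_notMem F j hj, mul_zero]
  · rw [mul_oddMonomial hs F.odd hk, map_smul]
    by_cases hjk : j = k
    · subst hjk
      rw [dOdd_monomial_of_mem F j (Finset.mem_insert_self j ν), if_pos rfl,
        dOdd_monomial_of_notMem F j hk, mul_zero, sub_zero, Finset.erase_insert hk, smul_smul,
        ← pow_add, Finset.filter_insert, if_neg (lt_irrefl j), Even.neg_one_pow ⟨_, rfl⟩, one_smul]
    · rw [if_neg hjk, zero_sub]
      by_cases hj : j ∈ ν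
      · have hk' : k ∉ ν.erase j := fun h => hk (Finset.mem_of_mem_erase h)
        rw [dOdd_monomial_of_mem F j (Finset.mem_insert_of_mem hj), dOdd_monomial_of_mem F j hj,
          mul_smul_comm, mul_oddMonomial hs F.odd hk', smul_smul, smul_smul, ← neg_smul,
          Finset.erase_insert_of_ne (Ne.symm hjk), ← pow_add, ← pow_add]
        congr 1
        -- Inserting `k` changes the sign of `∂_j` exactly when `k < j`, and erasing `j` changes the
        -- sign of `ξ_k` exactly when `j < k`. In either case precisely one sign changes, which is
        -- the minus in the relation.
        rcases lt_or_gt_of_ne hjk with hlt | hlt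
        · have h1 : (insert k ν).filter (· < j) = ν.filter (· < j) := by
            rw [Finset.filter_insert, if_neg hlt.not_gt]
          have h2 : ((ν.erase j).filter (· < k)).card + 1 = (ν.filter (· < k)).card := by
            rw [Finset.filter_erase, Finset.card_erase_add_one]
            simp [hj, hlt]
          rw [h1, ← h2]
          ring
        · have h1 : ((insert k ν).filter (· < j)).card = (ν.filter (· < j)).card + 1 := by
            rw [Finset.filter_insert, if_pos hlt, Finset.card_insert_of_notMem (by simp [hk])]
          have h2 : (ν.erase j).filter (· < k) = ν.filter (· < k) := by
            rw [Finset.filter_erase, Finset.erase_eq_of_notMem (by simp [hlt.not_gt])]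
          rw [h1, h2]
          ring
      · rw [dOdd_monomial_of_notMem F j hj, dOdd_monomial_of_notMem F j
          (by simp [hj, hjk]), smul_zero, mul_zero, neg_zero]

lemma dOdd_ξ_mul (k : Fin q) (f : A) :
    F.dOdd j (F.ξ k * f) = (if j = k then f else 0) - F.ξ k * F.dOdd j f := by
  refine F.induction (P := fun f =>
    F.dOdd j (F.ξ k * f) = (if j = k then f else 0) - F.ξ k * F.dOdd j f) ?_ ?_ f
  · intro f g hf hg
    rw [mul_add, map_add, hf, hg, map_add, mul_add]
    split_ifs <;> abel
  · intro a ν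
    have e : ∀ b, F.ξ k * (F.γ a * b) = F.γ a * (F.ξ k * b) := fun b => by
      rw [← mul_assoc, ← F.γ_comm, mul_assoc]
    rw [e, dOdd_γ_mul, dOdd_ξ_mul_monomial, dOdd_γ_mul, e, mul_sub]
    split_ifs <;> simp

@[simp] lemma dOdd_ξ (k : Fin q) : F.dOdd j (F.ξ k) = if j = k then 1 else 0 := by
  have := F.dOdd_ξ_mul j k (F.γ 1)
  rw [dOdd_γ] at this
  simpa using this

lemma dOdd_monomial_mul (ν : Finset (Fin q)) (g : A) :
    F.dOdd j (oddMonomial F.ξ ν * g) = F.dOdd j (oddMonomial F.ξ ν) * g +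
      (-1 : ℝ) ^ ν.card • (oddMonomial F.ξ ν * F.dOdd j g) := by
  induction ν using Finset.induction_on with
  | empty =>
    have := F.dOdd_γ j 1
    rw [map_one] at this
    simp [this]
  | insert k ν hk ih =>
    rw [oddMonomial_insert F.isSuper F.odd hk, Finset.card_insert_of_notMem hk, smul_mul_assoc,
      map_smul, map_smul, mul_assoc, dOdd_ξ_mul, ih, dOdd_ξ_mul, smul_mul_assoc, smul_mul_assoc,
      smul_comm ((-1 : ℝ) ^ (ν.card + 1)), ← smul_add]
    congr 1
    rw [pow_succ, mul_neg_one, neg_smul, mul_add, mul_smul_comm, sub_mul]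
    simp only [ite_mul, zero_mul, mul_assoc]
    abel

lemma dOdd_mul_of_even {f : A} (hf : f ∈ 𝒜 0) (g : A) :
    F.dOdd j (f * g) = F.dOdd j f * g + f * F.dOdd j g := by
  refine F.induction_of_mem (P := fun f =>
    F.dOdd j (f * g) = F.dOdd j f * g + f * F.dOdd j g) ?_ ?_ (by simp) hf
  · intro f₁ f₂ h₁ h₂
    simp only [add_mul, map_add, h₁, h₂]
    abel
  · intro a ν hν
    have : Even ν.card := (ZMod.natCast_eq_zero_iff_even).1 hν
    rw [mul_assoc, dOdd_γ_mul, dOdd_γ_mul, dOdd_monomial_mul, this.neg_one_pow, one_smul, mul_add]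
    simp only [mul_assoc]

lemma dOdd_mul_of_odd {f : A} (hf : f ∈ 𝒜 1) (g : A) :
    F.dOdd j (f * g) = F.dOdd j f * g - f * F.dOdd j g := by
  refine F.induction_of_mem (P := fun f =>
    F.dOdd j (f * g) = F.dOdd j f * g - f * F.dOdd j g) ?_ ?_ (by simp) hf
  · intro f₁ f₂ h₁ h₂
    simp only [add_mul, map_add, h₁, h₂]
    abel
  · intro a ν hν
    have : Odd ν.card := (ZMod.natCast_eq_one_iff_odd).1 hν
    rw [mul_assoc, dOdd_γ_mul, dOdd_γ_mul, dOdd_monomial_mul, this.neg_one_pow, neg_smul, one_smul,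
      ← sub_eq_add_neg, mul_sub]
    simp only [mul_assoc]

lemma dOdd_mem {a : ZMod 2} {f : A} (hf : f ∈ 𝒜 a) : F.dOdd j f ∈ 𝒜 (a + 1) := by
  refine F.induction_of_mem (P := fun f => F.dOdd j f ∈ 𝒜 (a + 1)) ?_ ?_ (by simp) hf
  · intro f g hf hg
    rw [map_add]
    exact Submodule.add_mem _ hf hg
  · intro g ν hν
    rw [dOdd_γ_mul]
    by_cases hj : j ∈ ν
    · rw [dOdd_monomial_of_mem F j hj, mul_smul_comm]
      refine Submodule.smul_mem _ _ ?_
      have e : ((ν.erase j).card : ZMod 2) = a + 1 := by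
        rw [← hν, ← Finset.card_erase_add_one hj, Nat.cast_add, Nat.cast_one, add_assoc,
          show (1 + 1 : ZMod 2) = 0 from rfl, add_zero]
      rw [← e]
      exact F.γ_mul_monomial_mem _ _
    · simp [dOdd_monomial_of_notMem F j hj]

lemma dOdd_anticomm (k : Fin q) (f : A) : F.dOdd j (F.dOdd k f) = -F.dOdd k (F.dOdd j f) := by
  refine F.induction_mul (P := fun f => F.dOdd j (F.dOdd k f) = -F.dOdd k (F.dOdd j f)) ?_ ?_ ?_ f
  · intro f g hf hg
    simp only [map_add, hf, hg, neg_add]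
  · simp
  · intro l f hf
    simp only [dOdd_ξ_mul, map_sub, hf]
    split_ifs <;> simp
    abel

/-- The coefficient of the highest monomial. -/
def top (f : A) : R := F.coeff f Finset.univ

/-- Every monomial of an odd derivative lacks the index `j`. This is the odd counterpart of the
vanishing of the integral of a total derivative. -/
lemma top_dOdd (f : A) : F.top (F.dOdd j f) = 0 := by
  rw [top, dOdd_eq, map_sum, Finset.sum_apply]
  refine Finset.sum_eq_zero fun ν _ => ?_
  rw [map_smul, coeff_γ_mul_X, Pi.smul_apply, Pi.single_eq_of_ne, smul_zero]
  intro h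
  exact Finset.notMem_erase j ν (h ▸ Finset.mem_univ j)

end dOdd

end Frame

/-! ### Derivatives of determinants -/

section Determinant

lemma det_updateRow_eq {ι C : Type*} [DecidableEq ι] [Fintype ι] [CommRing C] (W : Matrix ι ι C) (k : ι) (v : ι → C) :
    (W.updateRow k v).det = ∑ l, W.adjugate l k * v l := by
  rw [← Matrix.cramer_transpose_apply, Matrix.cramer_eq_adjugate_mulVec, ← Matrix.adjugate_transpose]
  rfl

variable {ι C N : Type*} [DecidableEq ι] [CommRing C] [Algebra ℝ C]

lemma derivation_prod [AddCommGroup N] [Module C N] [Module ℝ N] (D : Derivation ℝ C N)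
    (s : Finset ι) (f : ι → C) :
    D (∏ i ∈ s, f i) = ∑ i ∈ s, (∏ j ∈ s.erase i, f j) • D (f i) := by
  induction s using Finset.induction_on with
  | empty => simp
  | insert a s ha ih =>
    rw [Finset.prod_insert ha, Derivation.leibniz, ih, Finset.sum_insert ha,
      Finset.erase_insert ha, Finset.smul_sum, add_comm]
    congr 1
    refine Finset.sum_congr rfl fun i hi => ?_
    have hia : a ≠ i := fun h => ha (h ▸ hi)
    rw [Finset.erase_insert_of_ne hia,
      Finset.prod_insert (fun h => ha (Finset.mem_of_mem_erase h)), smul_smul]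

variable [Fintype ι]

/-- Jacobi's formula. -/
lemma derivation_det [AddCommGroup N] [Module C N] [Module ℝ N] (D : Derivation ℝ C N)
    (W : Matrix ι ι C) : D W.det = ∑ k, ∑ l, W.adjugate l k • D (W k l) := by
  -- The cofactor is the part of the Leibniz expansion with `σ l = k`, the factor in column `l`
  -- being omitted.
  have hadj : ∀ k l, W.adjugate l k =
      ∑ σ : Equiv.Perm ι, if σ l = k then
        (Equiv.Perm.sign σ : ℤ) • ∏ j ∈ Finset.univ.erase l, W (σ j) j else 0 := by
    intro k l
    have h1 : W.adjugate l k = (W.updateCol l (Pi.single k 1)).det := by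
      rw [← Matrix.cramer_apply, Matrix.cramer_eq_adjugate_mulVec, Matrix.mulVec_single_one]
      rfl
    rw [h1, Matrix.det_apply]
    refine Finset.sum_congr rfl fun σ _ => ?_
    rw [← Finset.mul_prod_erase _ _ (Finset.mem_univ l), Matrix.updateCol_self]
    have h2 : ∏ j ∈ Finset.univ.erase l, W.updateCol l (Pi.single k 1) (σ j) j =
        ∏ j ∈ Finset.univ.erase l, W (σ j) j :=
      Finset.prod_congr rfl fun j hj => Matrix.updateCol_ne (Finset.ne_of_mem_erase hj)
    rw [h2]
    split_ifs with h
    · rw [h, Pi.single_eq_same, one_mul]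
      rfl
    · rw [Pi.single_eq_of_ne h, zero_mul, smul_zero]
  rw [Matrix.det_apply, map_sum]
  simp_rw [hadj, Finset.sum_smul]
  have h3 : ∀ σ : Equiv.Perm ι, D (Equiv.Perm.sign σ • ∏ i, W (σ i) i) =
      ∑ l, ((Equiv.Perm.sign σ : ℤ) • ∏ j ∈ Finset.univ.erase l, W (σ j) j) • D (W (σ l) l) := by
    intro σ
    have : D (Equiv.Perm.sign σ • ∏ i, W (σ i) i) =
        (Equiv.Perm.sign σ : ℤ) • D (∏ i, W (σ i) i) := D.toLinearMap.toAddMonoidHom.map_zsmul _ _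
    rw [this, derivation_prod, Finset.smul_sum]
    exact Finset.sum_congr rfl fun l _ => (smul_assoc _ _ _).symm
  simp_rw [h3]
  rw [Finset.sum_comm]
  conv_rhs => rw [Finset.sum_comm]
  refine Finset.sum_congr rfl fun l _ => ?_
  rw [Finset.sum_comm]
  refine Finset.sum_congr rfl fun σ _ => ?_
  rw [Finset.sum_eq_single (σ l)]
  · simp
  · intro k _ hk
    simp [hk.symm]
  · simp

lemma derivation_det_row (D : Derivation ℝ C C) (W : Matrix ι ι C) :
    D W.det = ∑ k, (W.updateRow k fun l => D (W k l)).det := by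
  simp [derivation_det, det_updateRow_eq]

/-- The Piola identity: the rows of the adjugate of a Jacobian matrix are divergence free. -/
lemma sum_derivation_adjugate (δ : ι → Derivation ℝ C C)
    (hδ : ∀ i j a, δ i (δ j a) = δ j (δ i a)) (f : ι → C) (k : ι) :
    ∑ j, δ j ((Matrix.of fun i l => δ i (f l)).adjugate k j) = 0 := by
  set M : Matrix ι ι C := Matrix.of fun i l => δ i (f l) with hM
  set e : ι → C := Pi.single k 1 with he
  -- The adjugate entry is the determinant of `M` with row `j` replaced by a unit vector. In `H j r`
  -- its row `r` is moreover differentiated by `δ j`. Because the second derivatives are symmetric,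
  -- exchanging rows `j` and `r` turns `H j r` into `H r j`, so the double sum of determinants is
  -- antisymmetric; the diagonal terms have a zero row.
  set H : ι → ι → Matrix ι ι C := fun j r => (M.updateRow j e).updateRow r
    fun l => δ j (M.updateRow j e r l) with hH
  have h1 : ∑ j, δ j (M.adjugate k j) = ∑ j, ∑ r, (H j r).det := by
    refine Finset.sum_congr rfl fun j _ => ?_
    rw [Matrix.adjugate_apply, derivation_det_row]
  have h2 : ∀ j r, (H j r).det = -(H r j).det := by
    intro j r
    by_cases hjr : j = r
    · subst hjr
      have : (H j j).det = 0 := by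
        refine Matrix.det_eq_zero_of_row_eq_zero j fun l => ?_
        simp only [hH, Matrix.updateRow_self, he]
        by_cases hl : l = k
        · subst hl; simp
        · simp [hl]
      rw [this, neg_zero]
    · have : H r j = (H j r).submatrix (Equiv.swap j r) id := by
        ext i l
        simp only [hH, Matrix.submatrix_apply, id_eq]
        rw [Matrix.updateRow_ne (Ne.symm hjr), Matrix.updateRow_ne hjr]
        by_cases hij : i = j
        · subst hij
          simp only [Equiv.swap_apply_left, Matrix.updateRow_self, hM, Matrix.of_apply]
          exact hδ _ _ _
        · by_cases hir : i = r
          · subst hir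
            rw [Equiv.swap_apply_right, Matrix.updateRow_ne hij, Matrix.updateRow_self,
              Matrix.updateRow_ne hjr, Matrix.updateRow_self]
          · rw [Equiv.swap_apply_of_ne_of_ne hij hir, Matrix.updateRow_ne hij,
              Matrix.updateRow_ne hir, Matrix.updateRow_ne hir, Matrix.updateRow_ne hij]
      rw [this, Matrix.det_permute, Equiv.Perm.sign_swap hjr]
      simp
  have h3 : ∑ j, ∑ r, (H j r).det = -∑ j, ∑ r, (H j r).det := by
    conv_lhs => rw [Finset.sum_comm]
    rw [← Finset.sum_neg_distrib]
    refine Finset.sum_congr rfl fun j _ => ?_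
    rw [← Finset.sum_neg_distrib]
    exact Finset.sum_congr rfl fun r _ => h2 r j
  rw [h1]
  have h4 : (2 : ℝ) • ∑ j, ∑ r, (H j r).det = 0 := by
    rw [two_smul]
    nth_rewrite 1 [h3]
    simp
  simpa using h4

end Determinant

/-! ### The Lagrange operator -/

section Lagrange

/-- The operator `f ↦ ∑_i (1/i!) (-∂)^i (n^i f)`, where `i` runs over the multi-indices which are
supported on a given list and bounded by `K`. -/
def lagrange {ι A : Type*} [Ring A] [Algebra ℝ A] (δ : ι → A →ₗ[ℝ] A) (n : ι → A) (K : ℕ) :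
    List ι → A → A
  | [], f => f
  | l :: ls, f => ∑ m ∈ Finset.range (K + 1),
      ((m.factorial : ℝ)⁻¹) • ((-δ l) ^ m) (lagrange δ n K ls (n l ^ m * f))

lemma lagrange_cons {ι A : Type*} [Ring A] [Algebra ℝ A] (δ : ι → A →ₗ[ℝ] A) (n : ι → A) (K : ℕ)
    (l : ι) (ls : List ι) (f : A) : lagrange δ n K (l :: ls) f = ∑ m ∈ Finset.range (K + 1),
      ((m.factorial : ℝ)⁻¹) • ((-δ l) ^ m) (lagrange δ n K ls (n l ^ m * f)) := rfl

lemma lagrange_add {ι A : Type*} [Ring A] [Algebra ℝ A] (δ : ι → A →ₗ[ℝ] A) (n : ι → A) (K : ℕ)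
    (ls : List ι) (f g : A) :
    lagrange δ n K ls (f + g) = lagrange δ n K ls f + lagrange δ n K ls g := by
  induction ls generalizing f g with
  | nil => rfl
  | cons l ls ih => simp [lagrange_cons, mul_add, ih, Finset.sum_add_distrib]

lemma lagrange_smul {ι A : Type*} [Ring A] [Algebra ℝ A] (δ : ι → A →ₗ[ℝ] A) (n : ι → A) (K : ℕ)
    (ls : List ι) (r : ℝ) (f : A) :
    lagrange δ n K ls (r • f) = r • lagrange δ n K ls f := by
  induction ls generalizing f with
  | nil => rfl
  | cons l ls ih =>
    simp only [lagrange_cons, mul_smul_comm, ih, map_smul, Finset.smul_sum]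
    exact Finset.sum_congr rfl fun m _ => smul_comm _ _ _

/-- The Lagrange operator as a linear map. -/
def lagrangeLin {ι A : Type*} [Ring A] [Algebra ℝ A] (δ : ι → A →ₗ[ℝ] A) (n : ι → A) (K : ℕ)
    (ls : List ι) : A →ₗ[ℝ] A where
  toFun := lagrange δ n K ls
  map_add' := lagrange_add δ n K ls
  map_smul' := lagrange_smul δ n K ls

lemma lagrange_sum {ι κ A : Type*} [Ring A] [Algebra ℝ A] (δ : ι → A →ₗ[ℝ] A) (n : ι → A) (K : ℕ)
    (ls : List ι) (s : Finset κ) (f : κ → A) :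
    lagrange δ n K ls (∑ i ∈ s, f i) = ∑ i ∈ s, lagrange δ n K ls (f i) :=
  map_sum (lagrangeLin δ n K ls) f s

lemma lagrange_zero {ι A : Type*} [Ring A] [Algebra ℝ A] (δ : ι → A →ₗ[ℝ] A) (n : ι → A) (K : ℕ)
    (ls : List ι) : lagrange δ n K ls 0 = 0 := map_zero (lagrangeLin δ n K ls)

variable {ι C : Type*} [CommRing C] [Algebra ℝ C]
  (δ : ι → Derivation ℝ C C) (hδ : ∀ i j a, δ i (δ j a) = δ j (δ i a)) (u n : ι → C)
  {K : ℕ} (hn : ∀ l, n l ^ K = 0)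

/-- The Lagrange operator of a family of derivations of a commutative algebra. -/
abbrev derLagrange (K : ℕ) (ls : List ι) (f : C) : C :=
  lagrange (fun j => (δ j).toLinearMap) n K ls f

lemma neg_pow_mul_of_eq_zero (l : ι) {a : C} (ha : δ l a = 0) (m : ℕ) (g : C) :
    ((-(δ l).toLinearMap) ^ m) (a * g) = a * ((-(δ l).toLinearMap) ^ m) g := by
  induction m with
  | zero => simp
  | succ m ih =>
    rw [pow_succ', Module.End.mul_apply, ih, Module.End.mul_apply]
    simp [ha]

lemma neg_pow_mul_of_eq_one (l : ι) {a : C} (ha : δ l a = 1) (m : ℕ) (g : C) :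
    ((-(δ l).toLinearMap) ^ m) (a * g) = a * ((-(δ l).toLinearMap) ^ m) g -
      (m : ℝ) • ((-(δ l).toLinearMap) ^ (m - 1)) g := by
  induction m with
  | zero => simp
  | succ m ih =>
    rw [pow_succ', Module.End.mul_apply, ih, Module.End.mul_apply]
    rcases m with _ | m
    · simp [ha]
      ring
    · simp only [Nat.add_sub_cancel]
      rw [pow_succ', Module.End.mul_apply]
      simp [ha, add_smul]
      ring

include hδ in
lemma neg_pow_derivation (l j : ι) (m : ℕ) (g : C) :
    ((-(δ l).toLinearMap) ^ m) (δ j g) = δ j (((-(δ l).toLinearMap) ^ m) g) := by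
  induction m with
  | zero => simp
  | succ m ih =>
    rw [pow_succ', Module.End.mul_apply, ih, Module.End.mul_apply]
    simp [hδ l j]

/-- Since `m / m! = 1 / (m - 1)!`, this is a shift of the summation index. The one boundary term
left over is `T K K`, which vanishes in the applications by nilpotency of `n`. Two arguments of `T`
keep the order of differentiation and the exponent of `n` apart. -/
lemma sum_range_shift (T : ℕ → ℕ → C) (hT : T K K = 0) :
    ∑ m ∈ Finset.range (K + 1), ((m.factorial : ℝ)⁻¹) • ((m : ℝ) • T (m - 1) (m - 1)) =
      ∑ m ∈ Finset.range (K + 1), ((m.factorial : ℝ)⁻¹) • T m m := by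
  rw [Finset.sum_range_succ', Finset.sum_range_succ, hT]
  simp only [Nat.cast_zero, zero_smul, smul_zero, add_zero, Nat.add_sub_cancel]
  refine Finset.sum_congr rfl fun m _ => ?_
  rw [smul_smul, Nat.factorial_succ, Nat.cast_mul, mul_inv, mul_comm, ← mul_assoc,
    mul_inv_cancel₀ (by positivity), one_mul]

include hδ hn in
-- This is the transpose of the chain rule `∂_j (g(u + n)) = ∑_l ∂_j(u_l + n_l) (∂_l g)(u + n)`,
-- with `n_l` present only for the indices in the list.
lemma derLagrange_derivation (j : ι) (ls : List ι) (f : C) :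
    derLagrange δ n K ls (δ j f) = δ j (derLagrange δ n K ls f) +
      (ls.map fun l => δ l (derLagrange δ n K ls (δ j (n l) * f))).sum := by
  induction ls generalizing f with
  | nil => simp [derLagrange, lagrange]
  | cons l ls ih =>
    have e : ∀ m : ℕ, lagrange (fun j => (δ j).toLinearMap) n K ls (n l ^ m * δ j f) =
        δ j (derLagrange δ n K ls (n l ^ m * f)) +
        (ls.map fun l' => δ l' (derLagrange δ n K ls (n l ^ m * (δ j (n l') * f)))).sum -
        (m : ℝ) • derLagrange δ n K ls (n l ^ (m - 1) * (δ j (n l) * f)) := by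
      intro m
      -- The Leibniz rule moves `δ j` outside; the correction term will produce the summand of the
      -- new index `l`.
      have h1 : n l ^ m * δ j f =
          δ j (n l ^ m * f) - (m : ℝ) • (n l ^ (m - 1) * (δ j (n l) * f)) := by
        rw [Derivation.leibniz, Derivation.leibniz_pow]
        simp only [smul_eq_mul, ← Nat.cast_smul_eq_nsmul ℝ, mul_smul_comm]
        ring_nf
      simp only [derLagrange] at ih ⊢
      rw [h1, sub_eq_add_neg, ← neg_smul, lagrange_add, lagrange_smul, ih, neg_smul,
        ← sub_eq_add_neg]
      congr 2
      refine congrArg _ (List.map_congr_left fun l' _ => ?_)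
      congr 2
      ring
    have h2 : ∀ g : ℕ → ι → C, ∑ m ∈ Finset.range (K + 1), ((m.factorial : ℝ)⁻¹) •
        ((-(δ l).toLinearMap) ^ m) ((ls.map fun l' => δ l' (g m l')).sum) =
        (ls.map fun l' => δ l' (∑ m ∈ Finset.range (K + 1), ((m.factorial : ℝ)⁻¹) •
          ((-(δ l).toLinearMap) ^ m) (g m l'))).sum := by
      intro g
      clear e ih
      induction ls with
      | nil => simp
      | cons l' ls ih' =>
        simp only [List.map_cons, List.sum_cons, map_add, smul_add, Finset.sum_add_distrib, ih']
        congr 1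
        rw [map_sum]
        refine Finset.sum_congr rfl fun m _ => ?_
        rw [Derivation.map_smul, neg_pow_derivation δ hδ]
    have h3 := sum_range_shift (K := K) (fun a b => ((-(δ l).toLinearMap) ^ (a + 1))
        (derLagrange δ n K ls (n l ^ b * (δ j (n l) * f))))
        (by rw [hn, zero_mul, derLagrange, lagrange_zero, map_zero])
    -- After the index shift the correction carries one more factor `-δ l` than the terms of the
    -- operator for `l :: ls`, so it is minus the required summand.
    have h4 : ∑ m ∈ Finset.range (K + 1), ((m.factorial : ℝ)⁻¹) • ((-(δ l).toLinearMap) ^ m)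
        ((m : ℝ) • derLagrange δ n K ls (n l ^ (m - 1) * (δ j (n l) * f))) =
        -δ l (derLagrange δ n K (l :: ls) (δ j (n l) * f)) := by
      have h5 : -δ l (derLagrange δ n K (l :: ls) (δ j (n l) * f)) =
          ∑ m ∈ Finset.range (K + 1), ((m.factorial : ℝ)⁻¹) • ((-(δ l).toLinearMap) ^ (m + 1))
            (derLagrange δ n K ls (n l ^ m * (δ j (n l) * f))) := by
        simp only [derLagrange, lagrange_cons, map_sum]
        rw [← Finset.sum_neg_distrib]
        refine Finset.sum_congr rfl fun m _ => ?_
        rw [pow_succ', Module.End.mul_apply, Derivation.map_smul, ← smul_neg]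
        rfl
      rw [h5, ← h3]
      refine Finset.sum_congr rfl fun m _ => ?_
      rcases m with _ | m
      · simp
      · simp
    rw [List.map_cons, List.sum_cons, ← add_assoc]
    rw [show derLagrange δ n K (l :: ls) (δ j f) = _ from lagrange_cons _ _ _ _ _ _]
    simp only [e, map_add, map_sub, smul_add, smul_sub, Finset.sum_add_distrib,
      Finset.sum_sub_distrib, h4, h2]
    rw [sub_neg_eq_add]
    have h6 : ∑ m ∈ Finset.range (K + 1), ((m.factorial : ℝ)⁻¹) • ((-(δ l).toLinearMap) ^ m)
        (δ j (derLagrange δ n K ls (n l ^ m * f))) = δ j (derLagrange δ n K (l :: ls) f) := by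
      simp only [derLagrange, lagrange_cons, map_sum]
      refine Finset.sum_congr rfl fun m _ => ?_
      rw [Derivation.map_smul, neg_pow_derivation δ hδ]
    rw [h6, add_right_comm]
    rfl

variable [DecidableEq ι] (hu : ∀ j l, δ j (u l) = if j = l then 1 else 0)

include hu in
lemma derLagrange_u_mul {k : ι} {ls : List ι} (hk : k ∉ ls) (f : C) :
    derLagrange δ n K ls (u k * f) = u k * derLagrange δ n K ls f := by
  induction ls generalizing f with
  | nil => rfl
  | cons l ls ih =>
    rw [List.mem_cons, not_or] at hk
    have e : ∀ m, n l ^ m * (u k * f) = u k * (n l ^ m * f) := fun m => by ring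
    simp only [derLagrange, lagrange_cons, Finset.mul_sum, e] at ih ⊢
    refine Finset.sum_congr rfl fun m _ => ?_
    rw [ih hk.2, neg_pow_mul_of_eq_zero δ l (by rw [hu, if_neg (Ne.symm hk.1)]), mul_smul_comm]

include hu hn in
-- This is the transpose of the fact that Taylor expansion sends `u k` to `u k + n k`. The
-- commutator of `(-δ k)^m` with `u k` is `-m (-δ k)^(m-1)`; after a shift of the index it cancels
-- the contribution of `n k`.
lemma derLagrange_add_mul {k : ι} {ls : List ι} (hk : k ∈ ls) (hls : ls.Nodup) (f : C) :
    derLagrange δ n K ls ((u k + n k) * f) = u k * derLagrange δ n K ls f := by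
  induction ls generalizing f with
  | nil => simp at hk
  | cons l ls ih =>
    rw [List.nodup_cons] at hls
    by_cases hkl : k = l
    · subst hkl
      have e : ∀ m, lagrange (fun j => (δ j).toLinearMap) n K ls (n k ^ m * ((u k + n k) * f)) =
          u k * lagrange (fun j => (δ j).toLinearMap) n K ls (n k ^ m * f) +
            lagrange (fun j => (δ j).toLinearMap) n K ls (n k ^ (m + 1) * f) := by
        intro m
        rw [← derLagrange_u_mul δ u n hu hls.1, derLagrange, ← lagrange_add]
        congr 1
        ring
      simp only [derLagrange, lagrange_cons, e, map_add, smul_add, Finset.sum_add_distrib,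
        neg_pow_mul_of_eq_one δ k (a := u k) (by rw [hu, if_pos rfl]), smul_sub,
        Finset.sum_sub_distrib, Finset.mul_sum, mul_smul_comm]
      rw [sub_add, sub_eq_self, sub_eq_zero]
      have := sum_range_shift (K := K) (fun a b => ((-(δ k).toLinearMap) ^ a)
        (lagrange (fun j => (δ j).toLinearMap) n K ls (n k ^ (b + 1) * f)))
        (by rw [pow_succ, hn, zero_mul, zero_mul, lagrange_zero, map_zero])
      rw [← this]
      refine Finset.sum_congr rfl fun m _ => ?_
      rcases m with _ | m
      · simp
      · simp
    · have hk' : k ∈ ls := by simpa [hkl] using hk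
      have e : ∀ m, n l ^ m * ((u k + n k) * f) = (u k + n k) * (n l ^ m * f) := fun m => by ring
      simp only [derLagrange, lagrange_cons, Finset.mul_sum, e] at ih ⊢
      refine Finset.sum_congr rfl fun m _ => ?_
      rw [ih hk' hls.2, neg_pow_mul_of_eq_zero δ l (by rw [hu, if_neg (Ne.symm hkl)]),
        mul_smul_comm]

include hδ hu hn in
/-- The Lagrange operator maps the Jacobian determinant of `u + n` to `1`. -/
lemma derLagrange_det [Fintype ι] {ls : List ι} (hls : ls.Nodup) :
    derLagrange δ n K ls
      (Matrix.of fun j l => δ j (u l + if l ∈ ls then n l else 0)).det = 1 := by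
  induction ls with
  | nil =>
    have : (Matrix.of fun j l => δ j (u l + if l ∈ ([] : List ι) then n l else 0)) =
        (1 : Matrix ι ι C) := by
      ext j l
      simp [hu, Matrix.one_apply]
    rw [this, Matrix.det_one]
    rfl
  | cons l ls ih =>
    rw [List.nodup_cons] at hls
    set F : ι → C := fun k => u k + if k ∈ ls then n k else 0 with hF
    set M : Matrix ι ι C := Matrix.of fun j k => δ j (F k) with hM
    -- Adding `n l` changes column `l` only, and the determinant is linear in that column.
    have hdet : (Matrix.of fun j k => δ j (u k + if k ∈ l :: ls then n k else 0)).det =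
        M.det + ∑ j, M.adjugate l j * δ j (n l) := by
      have h1 : (Matrix.of fun j k => δ j (u k + if k ∈ l :: ls then n k else 0)) =
          M.updateCol l ((fun j => M j l) + fun j => δ j (n l)) := by
        ext j k
        by_cases hkl : k = l
        · subst hkl
          simp [hM, hF, hls.1]
        · simp [hM, hF, hkl]
      rw [h1, Matrix.det_updateCol_add, Matrix.updateCol_eq_self, ← Matrix.cramer_apply,
        Matrix.cramer_eq_adjugate_mulVec]
      rfl
    -- The transposed chain rule contracts the adjugate with `M`; by `adj M * M = det M` only the
    -- derivative along `l` remains.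
    have hkey : ∀ g, derLagrange δ n K ls (∑ j, δ j (g * M.adjugate l j)) =
        δ l (derLagrange δ n K ls (g * M.det)) := by
      intro g
      have hls' : ∀ j f, (ls.map fun l' => δ l' (derLagrange δ n K ls (δ j (n l') * f))).sum =
          ∑ l', δ l' (derLagrange δ n K ls (δ j (if l' ∈ ls then n l' else 0) * f)) := by
        intro j f
        rw [← List.sum_toFinset _ hls.2, ← Finset.sum_subset (Finset.subset_univ ls.toFinset)]
        · refine Finset.sum_congr rfl fun l' hl' => ?_
          rw [if_pos (List.mem_toFinset.1 hl')]
        · intro l' _ hl'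
          rw [if_neg (fun h => hl' (List.mem_toFinset.2 h)), map_zero, zero_mul, derLagrange,
            lagrange_zero, map_zero]
      have h2 : ∀ j f, derLagrange δ n K ls (δ j f) =
          ∑ l', δ l' (derLagrange δ n K ls (M j l' * f)) := by
        intro j f
        rw [derLagrange_derivation δ hδ n hn, hls']
        have h3 : ∀ l', M j l' * f = (if j = l' then f else 0) +
            δ j (if l' ∈ ls then n l' else 0) * f := by
          intro l'
          simp only [hM, hF, Matrix.of_apply, map_add, hu, add_mul, ite_mul, one_mul, zero_mul]
        simp only [h3, derLagrange, lagrange_add, map_add, Finset.sum_add_distrib]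
        congr 1
        rw [Finset.sum_eq_single j]
        · simp
        · intro l' _ hl'
          rw [if_neg (Ne.symm hl'), lagrange_zero, map_zero]
        · simp
      have h4 : ∀ l', ∑ j, M j l' * (g * M.adjugate l j) = if l = l' then g * M.det else 0 := by
        intro l'
        have := congrFun (congrFun (Matrix.adjugate_mul M) l) l'
        rw [Matrix.mul_apply, Matrix.smul_apply, Matrix.one_apply] at this
        calc ∑ j, M j l' * (g * M.adjugate l j) = g * ∑ j, M.adjugate l j * M j l' := by
              rw [Finset.mul_sum]
              exact Finset.sum_congr rfl fun j _ => by ring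
          _ = _ := by
              rw [this]
              split_ifs <;> simp
      rw [derLagrange, lagrange_sum]
      simp only [derLagrange] at h2 ⊢
      simp only [h2]
      rw [Finset.sum_comm]
      simp only [← map_sum, ← lagrange_sum, h4]
      rw [Finset.sum_eq_single l]
      · simp
      · intro l' _ hl'
        rw [if_neg (Ne.symm hl'), lagrange_zero, map_zero]
      · simp
    -- The rows of the adjugate are divergence free by the Piola identity, so the expression is a
    -- divergence and `hkey` applies.
    have hpow : ∀ m, n l ^ m * ∑ j, M.adjugate l j * δ j (n l) =
        ((m + 1 : ℕ) : ℝ)⁻¹ • ∑ j, δ j (n l ^ (m + 1) * M.adjugate l j) := by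
      intro m
      have h5 : ∑ j, δ j (n l ^ (m + 1) * M.adjugate l j) =
          ((m + 1 : ℕ) : ℝ) • (n l ^ m * ∑ j, M.adjugate l j * δ j (n l)) := by
        simp only [Derivation.leibniz, Finset.sum_add_distrib, smul_eq_mul]
        rw [← Finset.mul_sum, sum_derivation_adjugate δ hδ, mul_zero, zero_add, Finset.mul_sum,
          Finset.smul_sum]
        refine Finset.sum_congr rfl fun j _ => ?_
        rw [Derivation.leibniz_pow, Nat.add_sub_cancel, Nat.cast_smul_eq_nsmul, smul_eq_mul,
          mul_smul_comm]
        ring_nf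
      rw [h5, smul_smul, inv_mul_cancel₀ (by positivity), one_smul]
    rw [hdet]
    have h6 : ∀ m, lagrange (fun j => (δ j).toLinearMap) n K ls
        (n l ^ m * (M.det + ∑ j, M.adjugate l j * δ j (n l))) =
        derLagrange δ n K ls (n l ^ m * M.det) + ((m + 1 : ℕ) : ℝ)⁻¹ •
          δ l (derLagrange δ n K ls (n l ^ (m + 1) * M.det)) := by
      intro m
      rw [mul_add, hpow, lagrange_add, lagrange_smul]
      congr 2
      exact hkey _
    rw [show derLagrange δ n K (l :: ls) _ = _ from lagrange_cons _ _ _ _ _ _]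
    simp only [h6]
    -- Each summand is a difference of consecutive terms. The sum telescopes to the term `m = 0`,
    -- which is the statement for `ls`; the last term contains `n l ^ (K + 1) = 0`.
    have h7 : ∀ m, ((m.factorial : ℝ)⁻¹) • ((-(δ l).toLinearMap) ^ m)
        (derLagrange δ n K ls (n l ^ m * M.det) + ((m + 1 : ℕ) : ℝ)⁻¹ •
          δ l (derLagrange δ n K ls (n l ^ (m + 1) * M.det))) =
        ((m.factorial : ℝ)⁻¹) • ((-(δ l).toLinearMap) ^ m)
          (derLagrange δ n K ls (n l ^ m * M.det)) -
        (((m + 1).factorial : ℝ)⁻¹) • ((-(δ l).toLinearMap) ^ (m + 1))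
          (derLagrange δ n K ls (n l ^ (m + 1) * M.det)) := by
      intro m
      rw [map_add, smul_add, sub_eq_add_neg, map_smul, smul_smul, pow_succ (-(δ l).toLinearMap), Module.End.mul_apply,
        LinearMap.neg_apply, map_neg, smul_neg, neg_neg, Nat.factorial_succ, Nat.cast_mul, mul_inv,
        mul_comm (((m + 1 : ℕ) : ℝ)⁻¹)]
      rfl
    simp only [h7]
    rw [Finset.sum_range_sub', pow_succ (n l) K, hn]
    simp only [zero_mul, pow_zero, one_mul, Nat.factorial_zero, Nat.cast_one, inv_one, one_smul,
      Module.End.one_apply]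
    rw [ih hls.2, derLagrange, lagrange_zero, map_zero, smul_zero, sub_zero]

end Lagrange

/-! ### The commutative algebra of even elements -/

section EvenPart

variable {A : Type*} [Ring A] [Algebra ℝ A] {𝒜 : ZMod 2 → Submodule ℝ A}

/-- The commutative subalgebra of even elements. -/
def IsSuperalgebra.evenPart (h : IsSuperalgebra 𝒜) : Subalgebra ℝ A where
  carrier := 𝒜 0
  mul_mem' ha hb := by simpa using h.mul_mem ha hb
  add_mem' ha hb := Submodule.add_mem _ ha hb
  algebraMap_mem' r := by
    rw [Algebra.algebraMap_eq_smul_one]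
    exact Submodule.smul_mem _ _ h.one_mem

instance (h : IsSuperalgebra 𝒜) : CommRing h.evenPart :=
  { (inferInstance : Ring h.evenPart) with
    mul_comm := fun a b => Subtype.ext (h.even_comm a.2 b) }

lemma leibnizDet_coe (h : IsSuperalgebra 𝒜) {n : ℕ} (W : Matrix (Fin n) (Fin n) h.evenPart) :
    leibnizDet (Matrix.of fun i k => (W i k : A)) = (W.det : A) := by
  rw [leibnizDet, Matrix.det_apply]
  have : ∀ a : h.evenPart, (a : A) = h.evenPart.val.toRingHom a := fun _ => rfl
  rw [this, map_sum]
  refine Finset.sum_congr rfl fun σ _ => ?_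
  have e : (Equiv.Perm.sign σ • ∏ i, W (σ i) i) =
    (Equiv.Perm.sign σ : ℤ) • (List.ofFn fun i => W (σ i) i).prod := by
    rw [List.prod_ofFn]
    rfl
  rw [e, map_zsmul, map_list_prod, List.map_ofFn]
  rfl

end EvenPart

namespace Frame

variable {R A : Type*} [CommRing R] [Algebra ℝ R] [Ring A] [Algebra ℝ A] {q : ℕ}
  {𝒜 : ZMod 2 → Submodule ℝ A}

/-! ### Changes of the odd coordinates -/

section Odd

variable (F G : Frame R 𝒜 q)

/-- The derivative `∂/∂ξ_j` of even superfunctions. -/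
def dOddDerivation (h : IsSuperalgebra 𝒜) (j : Fin q) : Derivation ℝ h.evenPart A :=
  Derivation.mk' (F.dOdd j ∘ₗ h.evenPart.val.toLinearMap) fun a b => by
    refine (F.dOdd_mul_of_even j a.2 (b : A)).trans ?_
    rw [add_comm, ← h.even_comm b.2 (F.dOdd j a)]
    rfl

lemma dOddDerivation_apply (h : IsSuperalgebra 𝒜) (j : Fin q) (a : h.evenPart) :
    F.dOddDerivation h j a = F.dOdd j a := rfl

lemma dOdd_ξ_mem (i k : Fin q) : G.dOdd i (F.ξ k) ∈ 𝒜 0 := by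
  have := G.dOdd_mem i (F.odd k)
  rwa [show (1 + 1 : ZMod 2) = 0 from rfl] at this

/-- The Jacobian matrix `∂ξ_k/∂η_i`. -/
def oddJacobian (h : IsSuperalgebra 𝒜) : Matrix (Fin q) (Fin q) h.evenPart :=
  Matrix.of fun i k => ⟨G.dOdd i (F.ξ k), F.dOdd_ξ_mem G i k⟩

variable {F G} (hγ : F.γ = G.γ)
include hγ

/-- Both sides vanish on functions, the two retractions being equal, and both obey the same rule for
multiplication by `ξ l`; these generate everything. No even derivatives appear for the same reason.
-/
lemma dOdd_chain (i : Fin q) (f : A) :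
    G.dOdd i f = ∑ k, G.dOdd i (F.ξ k) * F.dOdd k f := by
  refine F.induction_mul (P := fun f => G.dOdd i f = ∑ k, G.dOdd i (F.ξ k) * F.dOdd k f)
    ?_ ?_ ?_ f
  · intro f g hf hg
    simp only [map_add, mul_add, Finset.sum_add_distrib, hf, hg]
  · intro a
    rw [hγ, dOdd_γ]
    simp [← hγ]
  · intro l f hf
    rw [G.dOdd_mul_of_odd i (F.odd l), hf]
    simp only [dOdd_ξ_mul, mul_sub, Finset.sum_sub_distrib]
    congr 1
    · rw [Finset.sum_eq_single l]
      · simp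
      · intro k _ hk
        simp [hk]
      · simp
    · rw [Finset.mul_sum]
      refine Finset.sum_congr rfl fun k _ => ?_
      rw [← mul_assoc, ← mul_assoc, F.isSuper.even_comm (F.dOdd_ξ_mem G i k)]

lemma oddJacobian_mul (h : IsSuperalgebra 𝒜) :
    F.oddJacobian G h * G.oddJacobian F h = 1 := by
  ext j k
  have := dOdd_chain hγ j (G.ξ k)
  rw [dOdd_ξ] at this
  rw [Matrix.mul_apply, Matrix.one_apply, AddSubmonoidClass.coe_finsetSum]
  refine Eq.trans this.symm ?_
  split_ifs <;> rfl

/-- Odd Piola identity, for `W = ∂η/∂ξ` with inverse `V`. Jacobi's formula gives `∂_{η_i} det W =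
det W ∑ V_{lk} ∂_{η_i} W_{kl}`. Contracting with `W_{ji}` turns `∂_{η_i}` into `∂_{ξ_j}`; exchanging
`∂_{ξ_j}` and `∂_{ξ_k}` on `η_l` gives a minus sign, and contracting with `V` gives `-∑_l ∂_{η_l}
W_{jl}`. This cancels the other Leibniz term. -/
lemma sum_dOdd_jacobian (h : IsSuperalgebra 𝒜) (j : Fin q) :
    ∑ i, G.dOdd i ((G.oddJacobian F h j i * (G.oddJacobian F h).det : h.evenPart) : A) = 0 := by
  set W := G.oddJacobian F h with hW
  set V := F.oddJacobian G h with hV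
  have hVW : V * W = 1 := oddJacobian_mul hγ h
  have hWV : W * V = 1 := oddJacobian_mul hγ.symm h
  have hadj : W.adjugate = W.det • V := by
    calc W.adjugate = W.adjugate * (W * V) := by rw [hWV, mul_one]
      _ = W.det • V := by rw [← mul_assoc, Matrix.adjugate_mul, Matrix.smul_mul, one_mul]
  have hWc : ∀ k l, (W k l : A) = F.dOdd k (G.ξ l) := fun _ _ => rfl
  have hd : ∀ i, G.dOdd i (W.det : A) =
      (W.det : A) * ∑ k, ∑ l, (V l k : A) * G.dOdd i (W k l : A) := by
    intro i
    have := derivation_det (G.dOddDerivation h i) W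
    rw [dOddDerivation_apply] at this
    rw [this, Finset.mul_sum]
    refine Finset.sum_congr rfl fun k _ => ?_
    rw [Finset.mul_sum]
    refine Finset.sum_congr rfl fun l _ => ?_
    rw [hadj, ← mul_assoc]
    rfl
  have h1 : ∀ i, G.dOdd i ((W j i * W.det : h.evenPart) : A) =
      (W.det : A) * (G.dOdd i (W j i : A) +
        ∑ k, ∑ l, (V l k : A) * ((W j i : A) * G.dOdd i (W k l : A))) := by
    intro i
    have e := G.dOdd_mul_of_even i (W j i).2 (W.det : A)
    have e' : ∀ x : A, (W j i : A) * ((W.det : A) * x) = (W.det : A) * ((W j i : A) * x) :=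
      fun x => by rw [← mul_assoc, h.even_comm (W j i).2, mul_assoc]
    rw [hd, e', ← h.even_comm W.det.2 (G.dOdd i (W j i : A)), ← mul_add, Finset.mul_sum] at e
    refine e.trans ?_
    congr 2
    refine Finset.sum_congr rfl fun k _ => ?_
    rw [Finset.mul_sum]
    refine Finset.sum_congr rfl fun l _ => ?_
    rw [← mul_assoc, h.even_comm (W j i).2, mul_assoc]
  have h2 : ∑ i, ∑ k, ∑ l, (V l k : A) * ((W j i : A) * G.dOdd i (W k l : A)) =
      -∑ l, G.dOdd l (W j l : A) := by
    rw [Finset.sum_comm]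
    have h3 : ∀ k, ∑ i, ∑ l, (V l k : A) * ((W j i : A) * G.dOdd i (W k l : A)) =
        -∑ l, (V l k : A) * F.dOdd k (W j l : A) := by
      intro k
      rw [Finset.sum_comm, ← Finset.sum_neg_distrib]
      refine Finset.sum_congr rfl fun l _ => ?_
      rw [← Finset.mul_sum, ← mul_neg, hWc j l, ← F.dOdd_anticomm, ← hWc k l,
        dOdd_chain hγ.symm j]
      rfl
    simp only [h3]
    rw [Finset.sum_neg_distrib, Finset.sum_comm]
    congr 1
    refine Finset.sum_congr rfl fun l _ => ?_
    rw [dOdd_chain hγ l]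
    rfl
  simp only [h1]
  rw [← Finset.mul_sum, Finset.sum_add_distrib, h2, add_neg_cancel, mul_zero]

end Odd

/-! ### Top coefficients of products -/

lemma top_γ_mul (G : Frame R 𝒜 q) (a : R) (f : A) : G.top (G.γ a * f) = a * G.top f :=
  G.coeff_γ_mul a f _

lemma top_add (G : Frame R 𝒜 q) (f g : A) : G.top (f + g) = G.top f + G.top g := by
  simp [top]

lemma top_sum (G : Frame R 𝒜 q) {κ : Type*} (s : Finset κ) (f : κ → A) :
    G.top (∑ i ∈ s, f i) = ∑ i ∈ s, G.top (f i) := by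
  simp [top]

lemma top_smul (G : Frame R 𝒜 q) (r : ℝ) (f : A) : G.top (r • f) = r • G.top f := by
  simp [top]

/-- The top coefficient of a product of linear forms in the odd coordinates. -/
lemma top_prod_linear (G : Frame R 𝒜 q) (N : Matrix (Fin q) (Fin q) R) :
    G.top (List.ofFn fun i => ∑ k, G.γ (N i k) * G.ξ k).prod = N.det := by
  -- The image of `γ` is central, so `A` is an `R`-algebra. Linear forms in the `ξ k` square to
  -- zero, hence their product factors through the exterior algebra and is alternating in the rows
  -- of `N`. An alternating `q`-form on `R^q` is its value on the standard basis times the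
  -- determinant.
  let _ : Algebra R A := G.γ.toRingHom.toAlgebra' fun a b => G.γ_comm a b
  have hsmul : ∀ (a : R) (b : A), a • b = G.γ a * b := fun a b => Algebra.smul_def a b
  let φ : (Fin q → R) →ₗ[R] A :=
    { toFun := fun v => ∑ k, G.γ (v k) * G.ξ k
      map_add' := fun v w => by simp [add_mul, Finset.sum_add_distrib]
      map_smul' := fun a v => by simp [hsmul, Finset.mul_sum, mul_assoc] }
  have hφ : ∀ v, φ v * φ v = 0 := fun v => by
    have hmem : ∑ k, G.γ (v k) * G.ξ k ∈ 𝒜 1 := Submodule.sum_mem _ fun k _ => by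
      have := G.isSuper.mul_mem (G.even (v k)) (G.odd k)
      rwa [zero_add] at this
    exact G.isSuper.odd_sq hmem
  let t : A →ₗ[R] R :=
    { toFun := G.top
      map_add' := G.top_add
      map_smul' := fun a f => by rw [hsmul, top_γ_mul]; rfl }
  let Φ : (Fin q → R) [⋀^Fin q]→ₗ[R] R :=
    (t ∘ₗ (ExteriorAlgebra.lift R ⟨φ, hφ⟩).toLinearMap).compAlternatingMap
      (ExteriorAlgebra.ιMulti R q)
  have hΦ : ∀ v, Φ v = G.top (List.ofFn fun i => φ (v i)).prod := by
    intro v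
    change G.top (ExteriorAlgebra.lift R ⟨φ, hφ⟩ (ExteriorAlgebra.ιMulti R q v)) = _
    rw [ExteriorAlgebra.ιMulti_apply, map_list_prod, List.map_ofFn]
    congr 3
    funext i
    exact ExteriorAlgebra.lift_ι_apply R φ hφ (v i)
  have hdet := congrArg (fun Ψ => Ψ N) (AlternatingMap.eq_smul_basis_det (Pi.basisFun R (Fin q)) Φ)
  have h1 : Φ (Pi.basisFun R (Fin q)) = 1 := by
    rw [hΦ]
    have : (List.ofFn fun i => φ ((Pi.basisFun R (Fin q)) i)) = List.ofFn G.ξ := by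
      congr 1
      funext i
      change ∑ k, G.γ ((Pi.basisFun R (Fin q)) i k) * G.ξ k = G.ξ i
      rw [Finset.sum_eq_single i]
      · simp
      · intro k _ hk
        simp [hk]
      · simp
    rw [this]
    have e : (List.ofFn G.ξ).prod = oddMonomial G.ξ Finset.univ := by simp [oddMonomial]
    rw [e, top, coeff_X, Pi.single_eq_same]
  rw [h1, one_smul, Pi.basisFun_det] at hdet
  exact (hΦ N).symm.trans hdet

/-- Replacing factors one at a time, each replacement raises the degree by one. For `n = q` the
error has degree above `q` and vanishes, so only the linear parts of odd coordinates enter their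
product. -/
lemma prod_sub_prod_mem_filt (G : Frame R 𝒜 q) {n : ℕ} (a b : Fin n → A)
    (ha : ∀ i, a i ∈ G.filt 1) (hb : ∀ i, b i ∈ G.filt 1) (hab : ∀ i, a i - b i ∈ G.filt 2) :
    (List.ofFn a).prod ∈ G.filt n ∧ (List.ofFn b).prod ∈ G.filt n ∧
      (List.ofFn a).prod - (List.ofFn b).prod ∈ G.filt (n + 1) := by
  induction n with
  | zero =>
    refine ⟨fun μ hμ => by omega, fun μ hμ => by omega, ?_⟩
    simp
  | succ n ih =>
    obtain ⟨h1, h2, h3⟩ := ih (fun i => a i.succ) (fun i => b i.succ) (fun i => ha _)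
      (fun i => hb _) (fun i => hab _)
    rw [List.ofFn_succ, List.ofFn_succ, List.prod_cons, List.prod_cons]
    refine ⟨?_, ?_, ?_⟩
    · have := G.mul_mem_filt (ha 0) h1
      rwa [add_comm 1 n] at this
    · have := G.mul_mem_filt (hb 0) h2
      rwa [add_comm 1 n] at this
    · have e : a 0 * (List.ofFn fun i => a i.succ).prod - b 0 * (List.ofFn fun i => b i.succ).prod =
        (a 0 - b 0) * (List.ofFn fun i => a i.succ).prod +
          b 0 * ((List.ofFn fun i => a i.succ).prod - (List.ofFn fun i => b i.succ).prod) := by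
        noncomm_ring
      rw [e]
      refine Submodule.add_mem _ ?_ ?_
      · have := G.mul_mem_filt (hab 0) h1
        rwa [show 2 + n = n + 1 + 1 by omega] at this
      · have := G.mul_mem_filt (hb 0) h3
        rwa [show 1 + (n + 1) = n + 1 + 1 by omega] at this

lemma coeff_dOdd_empty (G : Frame R 𝒜 q) (i : Fin q) (f : A) :
    G.coeff (G.dOdd i f) ∅ = G.coeff f {i} := by
  rw [dOdd_eq, map_sum, Finset.sum_apply, Finset.sum_eq_single {i}]
  · rw [map_smul, Finset.erase_singleton, coeff_γ_mul_X, Finset.filter_singleton,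
      if_neg (lt_irrefl i)]
    simp
  · intro ν hν hne
    rw [map_smul, coeff_γ_mul_X, Pi.smul_apply, Pi.single_eq_of_ne, smul_zero]
    intro h
    apply hne
    rw [← Finset.insert_erase (Finset.mem_filter.1 hν).2, ← h]
    rfl
  · simp

/-! ### Invariance of the top coefficient under odd coordinate changes -/

section OddChange

variable [IsReduced R] {β : A →ₐ[ℝ] R} {F G : Frame R 𝒜 q} (hβ : ∀ a, β (G.γ a) = a)

lemma mul_eq_of_mem_filt (G : Frame R 𝒜 q) (hβ : ∀ a, β (G.γ a) = a) {f : A} (hf : f ∈ G.filt q)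
    (g : A) : f * g = G.γ (β g) * f := by
  have h1 : g - G.γ (β g) ∈ G.filt 1 := (G.mem_filt_one_iff hβ).2 (by simp [hβ])
  have h2 := G.eq_zero_of_mem_filt (Nat.lt_succ_self q) (G.mul_mem_filt hf h1)
  rw [mul_sub, sub_eq_zero] at h2
  rw [h2, G.γ_comm]

include hβ in
-- The product of all `ξ_i` equals the product of their linear parts in `η`, so its top coefficient
-- is the determinant of the matrix of linear coefficients. That matrix is, up to transposition, the
-- body of `∂ξ/∂η`, and the other factor has the inverse determinant as its body. Only this body
-- matters against an element of degree `q`.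
lemma top_monomial_univ (hγ : F.γ = G.γ) (h : IsSuperalgebra 𝒜) :
    G.top (oddMonomial F.ξ Finset.univ * ((G.oddJacobian F h).det : A)) = 1 := by
  set N : Matrix (Fin q) (Fin q) R := Matrix.of fun i k => G.coeff (F.ξ i) {k} with hN
  have hodd : ∀ i, ∀ μ : Finset (Fin q), μ.card < 1 → G.coeff (F.ξ i) μ = 0 := by
    intro i μ hμ
    refine G.coeff_eq_zero_of_mem (F.odd i) ?_
    rw [Nat.lt_one_iff.1 hμ]
    decide
  have hlin : ∀ i, ∀ μ, G.coeff (∑ k, G.γ (N i k) * G.ξ k) μ =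
      ∑ k, if μ = {k} then G.coeff (F.ξ i) {k} else 0 := by
    intro i μ
    rw [map_sum, Finset.sum_apply]
    refine Finset.sum_congr rfl fun k _ => ?_
    rw [← monomial_singleton, coeff_γ_mul_X]
    by_cases hμ : μ = {k}
    · subst hμ; simp [hN]
    · simp [hμ]
  obtain ⟨h1, -, h3⟩ := G.prod_sub_prod_mem_filt F.ξ (fun i => ∑ k, G.γ (N i k) * G.ξ k) hodd
    (by
      intro i μ hμ
      rw [hlin]
      refine Finset.sum_eq_zero fun k _ => if_neg ?_
      rintro rfl
      simp at hμ)
    (by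
      intro i μ hμ
      rw [map_sub, Pi.sub_apply, hlin, sub_eq_zero]
      rcases Nat.lt_succ_iff_lt_or_eq.1 hμ with h | h
      · rw [hodd i μ h, eq_comm]
        refine Finset.sum_eq_zero fun k _ => if_neg ?_
        rintro rfl
        simp at h
      · obtain ⟨k, rfl⟩ := Finset.card_eq_one.1 h
        rw [Finset.sum_eq_single k]
        · simp
        · intro l _ hl
          rw [if_neg]
          simpa using hl.symm
        · simp)
  have h4 := sub_eq_zero.1 (G.eq_zero_of_mem_filt (Nat.lt_succ_self q) h3)
  have e : oddMonomial F.ξ Finset.univ = (List.ofFn F.ξ).prod := by simp [oddMonomial]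
  have hdet : β ((G.oddJacobian F h).det : A) * N.det = 1 := by
    have hmul := congrArg (fun M => ((M.det : h.evenPart) : A)) (oddJacobian_mul hγ.symm h)
    simp only [Matrix.det_mul, Matrix.det_one] at hmul
    have hmul' := congrArg β (show ((G.oddJacobian F h).det : A) * ((F.oddJacobian G h).det : A) = 1
      from hmul)
    rw [map_mul, map_one] at hmul'
    have hV : β ((F.oddJacobian G h).det : A) = N.det := by
      have : ∀ a : h.evenPart, β (a : A) = (β.comp h.evenPart.val) a := fun _ => rfl
      rw [this, AlgHom.map_det, ← Matrix.det_transpose]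
      congr 1
      ext i k
      change β (G.dOdd k (F.ξ i)) = _
      rw [G.body_eq hβ, coeff_dOdd_empty]
      rfl
    rw [← hV]
    exact hmul'
  rw [e, G.mul_eq_of_mem_filt hβ h1, top_γ_mul, h4, top_prod_linear, hdet]

include hβ in
/-- The Berezin integral is invariant under changes of the odd coordinates. -/
lemma top_mul_det_oddJacobian (hγ : F.γ = G.γ) (h : IsSuperalgebra 𝒜) (f : A) :
    G.top (f * ((G.oddJacobian F h).det : A)) = F.top f := by
  set d : A := ((G.oddJacobian F h).det : A) with hd
  -- By the chain rule and the odd Piola identity, `∂_{ξ_j} g` times the determinant is a sum of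
  -- `η`-derivatives.
  have h1 : ∀ j g, G.top (F.dOdd j g * d) = 0 := by
    intro j g
    have e : F.dOdd j g * d = ∑ i,
        (G.dOdd i ((G.oddJacobian F h j i * (G.oddJacobian F h).det : h.evenPart) * g) -
          G.dOdd i ((G.oddJacobian F h j i * (G.oddJacobian F h).det : h.evenPart) : A) * g) := by
      rw [dOdd_chain hγ.symm j g, Finset.sum_mul]
      refine Finset.sum_congr rfl fun i _ => ?_
      have e1 := G.dOdd_mul_of_even i
        (G.oddJacobian F h j i * (G.oddJacobian F h).det : h.evenPart).2 g
      refine Eq.trans ?_ (eq_sub_of_add_eq' e1.symm)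
      rw [mul_assoc, ← h.even_comm (G.oddJacobian F h).det.2, ← mul_assoc]
      rfl
    rw [e, Finset.sum_sub_distrib, ← Finset.sum_mul, sum_dOdd_jacobian hγ h, zero_mul, sub_zero,
      top_sum]
    exact Finset.sum_eq_zero fun i _ => G.top_dOdd i _
  conv_lhs => rw [F.sum_coeff f, Finset.sum_mul, top_sum]
  rw [Finset.sum_eq_single Finset.univ]
  · rw [hγ, mul_assoc, top_γ_mul, hd, top_monomial_univ hβ hγ h, mul_one]
    rfl
  · intro ν _ hν
    obtain ⟨j, hj⟩ : ∃ j, j ∉ ν := by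
      by_contra! hall
      exact hν (Finset.eq_univ_iff_forall.2 hall)
    -- A monomial that lacks the index `j` is itself a `ξ_j`-derivative, so it does not contribute.
    have : oddMonomial F.ξ ν = F.dOdd j (F.ξ j * oddMonomial F.ξ ν) := by
      rw [dOdd_ξ_mul, if_pos rfl, dOdd_monomial_of_notMem F j hj, mul_zero, sub_zero]
    rw [hγ, mul_assoc, top_γ_mul, this, h1, mul_zero]
  · simp

end OddChange

/-! ### Changes of the retraction -/

section Even

variable {β : A →ₐ[ℝ] R} {F G : Frame R 𝒜 q} (hF : ∀ a, β (F.γ a) = a)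
  (hG : ∀ a, β (G.γ a) = a) (hξ : F.ξ = G.ξ) {p : ℕ} (δ : Fin p → Derivation ℝ R R)
  (hδ : ∀ i j a, δ i (δ j a) = δ j (δ i a)) (u : Fin p → R)
  (hu : ∀ j l, δ j (u l) = if j = l then 1 else 0) {Pt : Type*} (ev : Pt → R →ₐ[ℝ] ℝ)
  (hev : ∀ a, (∀ m, ev m a = 0) → a = 0)
  (hadamard : ∀ h m, ∃ c : Fin p → R, h = algebraMap ℝ R (ev m h) +
    ∑ l, (u l - algebraMap ℝ R (ev m (u l))) * c l)

include hξ hu hev hadamard in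
/-- The chain rule for the even derivatives of two frames with the same odd coordinates. -/
lemma dEven_chain (j : Fin p) (f : A) :
    F.dEven (δ j) f = ∑ l, F.dEven (δ j) (G.γ (u l)) * G.dEven (δ l) f := by
  have h := F.isSuper
  -- The difference of the two sides satisfies the Leibniz rule and kills the odd monomials and the
  -- coordinates `G.γ (u l)`; it remains to see that it kills `G.γ a` for every `a`.
  set D : A →ₗ[ℝ] A := F.dEven (δ j) -
    ∑ l, LinearMap.mulLeft ℝ (F.dEven (δ j) (G.γ (u l))) ∘ₗ G.dEven (δ l) with hD
  have hDa : ∀ f, D f = F.dEven (δ j) f - ∑ l, F.dEven (δ j) (G.γ (u l)) * G.dEven (δ l) f := by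
    intro f
    simp [hD]
  have hDmul : ∀ f g, D (f * g) = D f * g + f * D g := by
    intro f g
    simp only [hDa, dEven_mul, mul_add, Finset.sum_add_distrib, sub_mul, mul_sub]
    have e : ∑ l, F.dEven (δ j) (G.γ (u l)) * (f * G.dEven (δ l) g) =
        f * ∑ l, F.dEven (δ j) (G.γ (u l)) * G.dEven (δ l) g := by
      rw [Finset.mul_sum]
      refine Finset.sum_congr rfl fun l _ => ?_
      rw [← mul_assoc, h.even_comm (F.dEven_mem _ (G.even _)), mul_assoc]
    rw [e, Finset.sum_mul]
    simp only [mul_assoc]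
    abel
  have hDX : ∀ ν, D (oddMonomial G.ξ ν) = 0 := by
    intro ν
    rw [hDa, ← hξ, dEven_monomial, zero_sub, hξ, neg_eq_zero]
    exact Finset.sum_eq_zero fun l _ => by rw [dEven_monomial, mul_zero]
  have hDu : ∀ l, D (G.γ (u l)) = 0 := by
    intro l
    rw [hDa, sub_eq_zero, Finset.sum_eq_single l]
    · rw [dEven_γ, hu, if_pos rfl, map_one, mul_one]
    · intro k _ hk
      rw [dEven_γ, hu, if_neg hk, map_zero, mul_zero]
    · simp
  have hD1 : ∀ r, D (algebraMap ℝ A r) = 0 := by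
    intro r
    have := hDX ∅
    rw [oddMonomial_empty] at this
    rw [Algebra.algebraMap_eq_smul_one, map_smul, this, smul_zero]
  -- Hadamard's expansion at a point `m` leaves only terms with a factor `u l - u l (m)`, so all
  -- coefficients of `D (G.γ a)` vanish at `m`. As `m` is arbitrary, they vanish.
  have hDγ : ∀ a, D (G.γ a) = 0 := by
    intro a
    refine G.coeff_injective fun ν => ?_
    rw [map_zero]
    refine hev _ fun m => ?_
    obtain ⟨c, hc⟩ := hadamard a m
    have e : D (G.γ a) =
        ∑ l, G.γ (u l - algebraMap ℝ R (ev m (u l))) * D (G.γ (c l)) := by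
      conv_lhs => rw [hc]
      simp only [map_add, map_sum, map_mul, map_sub, AlgHom.commutes, hD1, hDmul, hDu]
      simp
    rw [e, map_sum, Finset.sum_apply, map_sum]
    refine Finset.sum_eq_zero fun l _ => ?_
    rw [coeff_γ_mul, map_mul, map_sub, AlgHom.commutes]
    simp
  have h0 : D f = 0 := by
    refine G.induction (P := fun f => D f = 0) ?_ ?_ f
    · intro f g hf hg
      rw [map_add, hf, hg, add_zero]
    · intro a ν
      rw [hDmul, hDγ, hDX, zero_mul, mul_zero, add_zero]
  rwa [hDa, sub_eq_zero] at h0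

/-- The derivation of even superfunctions given by an even derivative. -/
def dEvenDerivation (F : Frame R 𝒜 q) (h : IsSuperalgebra 𝒜) (δ : Derivation ℝ R R) :
    Derivation ℝ h.evenPart h.evenPart :=
  Derivation.mk' (LinearMap.codRestrict h.evenPart.toSubmodule
      (F.dEven δ ∘ₗ h.evenPart.val.toLinearMap) fun a => F.dEven_mem δ a.2) fun a b => by
    refine Subtype.ext ((F.dEven_mul δ (a : A) (b : A)).trans ?_)
    rw [add_comm, ← h.even_comm b.2 (F.dEven δ a)]
    rfl

/-- The even derivatives kill `ξ^ν`, so it can be carried along as a constant. This transfers the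
results on commutative algebras, applied to the even part, to all superfunctions. -/
lemma lagrange_mul_monomial (F : Frame R 𝒜 q) (h : IsSuperalgebra 𝒜)
    (n : Fin p → h.evenPart) (K : ℕ) (ls : List (Fin p)) (c : h.evenPart) (ν : Finset (Fin q)) :
    lagrange (fun j => F.dEven (δ j)) (fun j => (n j : A)) K ls (c * oddMonomial F.ξ ν) =
      ((derLagrange (fun j => F.dEvenDerivation h (δ j)) n K ls c : h.evenPart) : A) * oddMonomial F.ξ ν := by
  induction ls generalizing c with
  | nil => rfl
  | cons l ls ih =>
    have hpow : ∀ (m : ℕ) (a : h.evenPart),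
        ((-F.dEven (δ l)) ^ m) ((a : A) * oddMonomial F.ξ ν) =
        (((-(F.dEvenDerivation h (δ l)).toLinearMap) ^ m) a : A) * oddMonomial F.ξ ν := by
      intro m a
      induction m with
      | zero => rfl
      | succ m ihm =>
        rw [pow_succ', Module.End.mul_apply, ihm, pow_succ', Module.End.mul_apply,
          LinearMap.neg_apply, dEven_mul, dEven_monomial, mul_zero, add_zero, ← neg_mul]
        rfl
    rw [derLagrange, lagrange_cons, lagrange_cons, AddSubmonoidClass.coe_finsetSum,
      Finset.sum_mul]
    refine Finset.sum_congr rfl fun m _ => ?_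
    have e : (n l : A) ^ m * ((c : A) * oddMonomial F.ξ ν) =
        ((n l ^ m * c : h.evenPart) : A) * oddMonomial F.ξ ν := by
      rw [← mul_assoc]
      rfl
    rw [e, ih, hpow, ← smul_mul_assoc]
    rfl

include hF hG hξ hδ hu hev hadamard in
/-- The Berezin integral under a change of the retraction. -/
lemma top_mul_leibnizDet [IsReduced R] (f : A) :
    G.top (f * leibnizDet (Matrix.of fun i k => G.dEven (δ i) (F.γ (u k)))) =
      F.top (lagrange (fun j => F.dEven (δ j)) (fun l => G.γ (u l) - F.γ (u l)) (q + 1)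
        (List.finRange p) f) := by
  have h := F.isSuper
  set uC : Fin p → h.evenPart := fun l => ⟨F.γ (u l), F.even _⟩ with huC
  set vC : Fin p → h.evenPart := fun l => ⟨G.γ (u l), G.even _⟩ with hvC
  set nC : Fin p → h.evenPart := fun l => vC l - uC l with hnC
  set D : Fin p → Derivation ℝ h.evenPart h.evenPart :=
    fun j => F.dEvenDerivation h (δ j) with hD
  have hDD : ∀ i j a, D i (D j a) = D j (D i a) := fun i j a =>
    Subtype.ext (F.dEven_comm (hδ i j) a)
  have hDu : ∀ j l, D j (uC l) = if j = l then 1 else 0 := by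
    intro j l
    refine Subtype.ext ?_
    change F.dEven (δ j) (F.γ (u l)) = _
    rw [dEven_γ, hu]
    split_ifs <;> simp
  -- The difference of two retractions has zero body, hence odd degree at least one, and degrees end
  -- at `q`. This is the source of the bound `q + 1`.
  have hn : ∀ l, nC l ^ (q + 1) = 0 := by
    intro l
    refine Subtype.ext ?_
    change (G.γ (u l) - F.γ (u l)) ^ (q + 1) = 0
    exact F.pow_eq_zero ((F.mem_filt_one_iff hF).2 (by simp [hF, hG])) (Nat.lt_succ_self q)
  set L : h.evenPart → h.evenPart := derLagrange D nC (q + 1) (List.finRange p) with hL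
  set M : Matrix (Fin p) (Fin p) h.evenPart := Matrix.of fun j l => D j (vC l) with hM
  set S : Matrix (Fin p) (Fin p) h.evenPart :=
    Matrix.of fun i k => ⟨G.dEven (δ i) (F.γ (u k)), G.dEven_mem _ (F.even _)⟩ with hS
  have hLM : L M.det = 1 := by
    have := derLagrange_det D hDD uC nC hn hDu (List.nodup_finRange p)
    rw [← this]
    congr 2
    ext j l
    simp [hM, hnC]
  -- The chain rule applied to the coordinates `F.γ (u k)`: the matrices are `∂v/∂u` and `∂u/∂v`.
  have hMS : M * S = 1 := by
    ext j k
    have := dEven_chain hξ δ u hu ev hev hadamard j (F.γ (u k))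
    rw [dEven_γ, hu] at this
    rw [Matrix.mul_apply, Matrix.one_apply, AddSubmonoidClass.coe_finsetSum]
    refine Eq.trans this.symm ?_
    split_ifs <;> simp
  have hdet : M.det * S.det = 1 := by rw [← Matrix.det_mul, hMS, Matrix.det_one]
  have hLv : ∀ l (r : ℝ) c, L ((vC l - algebraMap ℝ _ r) * c) =
      (uC l - algebraMap ℝ _ r) * L c := by
    intro l r c
    have h1 := derLagrange_add_mul D uC nC hn hDu (List.mem_finRange l) (List.nodup_finRange p) c
    have e : uC l + nC l = vC l := by simp [hnC]
    rw [e] at h1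
    rw [sub_mul, sub_mul, ← h1, ← Algebra.smul_def, ← Algebra.smul_def, sub_eq_add_neg, ← neg_smul,
      hL, derLagrange, lagrange_add, lagrange_smul, neg_smul, sub_eq_add_neg]
  -- For coordinates this is `hLv`. In general, Hadamard's expansion of `a` at `m` lets `L` exchange
  -- `v l` for `u l`, and the remaining terms vanish at `m`; the coefficients of both sides
  -- therefore agree at every point.
  have hLγ : ∀ a c, (L ((⟨G.γ a, G.even a⟩ : h.evenPart) * c) : A) = F.γ a * (L c : A) := by
    intro a c
    refine F.coeff_injective fun ν => ?_
    rw [← sub_eq_zero]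
    refine hev _ fun m => ?_
    obtain ⟨b, hb⟩ := hadamard a m
    have e : (⟨G.γ a, G.even a⟩ : h.evenPart) * c = (ev m a) • c +
        ∑ l, (vC l - algebraMap ℝ _ (ev m (u l))) * (⟨G.γ (b l), G.even _⟩ * c) := by
      have e1 : (⟨G.γ a, G.even a⟩ : h.evenPart) = algebraMap ℝ _ (ev m a) +
          ∑ l, (vC l - algebraMap ℝ _ (ev m (u l))) * ⟨G.γ (b l), G.even _⟩ := by
        refine Subtype.ext ?_
        change G.γ a = _
        conv_lhs => rw [hb]
        simp only [map_add, map_sum, map_mul, map_sub, AlgHom.commutes]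
        rw [AddMemClass.coe_add, AddSubmonoidClass.coe_finsetSum]
        rfl
      rw [e1, add_mul, ← Algebra.smul_def, Finset.sum_mul]
      simp only [mul_assoc]
    rw [e, hL, derLagrange, lagrange_add, lagrange_smul, lagrange_sum]
    have e2 : ∀ x : h.evenPart, lagrange (fun j => (D j).toLinearMap) nC (q + 1)
      (List.finRange p) x = L x := fun _ => rfl
    simp only [e2, hLv]
    rw [AddMemClass.coe_add, AddSubmonoidClass.coe_finsetSum, map_add, Pi.add_apply, map_sum,
      Finset.sum_apply, coeff_γ_mul, map_sub, map_add, map_sum]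
    have e3 : ∀ l x, F.coeff (((uC l - algebraMap ℝ h.evenPart (ev m (u l))) * x : h.evenPart) : A) ν =
        (u l - algebraMap ℝ R (ev m (u l))) * F.coeff (x : A) ν := by
      intro l x
      rw [← coeff_γ_mul, map_sub, AlgHom.commutes]
      rfl
    simp only [e3, map_mul, map_sub, AlgHom.commutes]
    have e4 : F.coeff ((ev m a • L c : h.evenPart) : A) ν = ev m a • F.coeff (L c : A) ν :=
      congrFun (F.coeff.map_smul (ev m a) (L c : A)) ν
    rw [e4, map_smul]
    simp
  have hSd : leibnizDet (Matrix.of fun i k => G.dEven (δ i) (F.γ (u k))) = (S.det : A) :=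
    leibnizDet_coe h S
  rw [hSd]
  set g : A := f * (S.det : A) with hg
  -- Multiplying `g = f det S` by `det M` recovers `f`. In this form `L` replaces `G.γ` by `F.γ` and
  -- turns `det M` into `1`.
  have hf : f = ∑ ν, ((⟨G.γ (G.coeff g ν), G.even _⟩ * M.det : h.evenPart) : A) *
      oddMonomial F.ξ ν := by
    have e1 : f = (M.det : A) * g := by
      rw [hg, ← mul_assoc, h.even_comm M.det.2, mul_assoc]
      have : (M.det : A) * (S.det : A) = 1 := congrArg Subtype.val hdet
      rw [this, mul_one]
    conv_lhs => rw [e1, G.sum_coeff g, Finset.mul_sum]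
    refine Finset.sum_congr rfl fun ν _ => ?_
    rw [← mul_assoc, h.even_comm M.det.2, hξ]
    rfl
  have hres : lagrange (fun j => F.dEven (δ j)) (fun l => G.γ (u l) - F.γ (u l)) (q + 1)
      (List.finRange p) f = F.ofCoeffs (G.coeff g) := by
    conv_lhs => rw [hf, lagrange_sum]
    rw [ofCoeffs_apply]
    refine Finset.sum_congr rfl fun ν _ => ?_
    have e1 := F.lagrange_mul_monomial δ h nC (q + 1) (List.finRange p)
      (⟨G.γ (G.coeff g ν), G.even _⟩ * M.det) ν
    refine e1.trans ?_
    congr 1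
    have e2 := hLγ (G.coeff g ν) M.det
    rw [hLM] at e2
    refine e2.trans ?_
    exact mul_one _
  rw [hres, top, top, coeff_ofCoeffs]

end Even

end Frame

/-! ### Hadamard's lemma -/

section Hadamard

variable {p : ℕ}

/-- The integral is a convolution evaluated at `0`: the indicator function of `(0, 1]` against `t ↦
χ(t) ψ(-t, e)`. The bump `χ` provides compact support and equals `1` on `[-2, 2]`, so it does not
alter the integrand. -/
lemma contDiff_integral_param {P : Type*} [NormedAddCommGroup P] [NormedSpace ℝ P]
    {ψ : ℝ × P → ℝ} (hψ : ContDiff ℝ ∞ ψ) :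
    ContDiff ℝ ∞ fun e => ∫ s in (0 : ℝ)..1, ψ (s, e) := by
  let χ : ContDiffBump (0 : ℝ) := ⟨2, 3, by norm_num, by norm_num⟩
  let f : ℝ → ℝ := (Set.Ioc (0 : ℝ) 1).indicator fun _ => 1
  let g : P → ℝ → ℝ := fun e t => χ t * ψ (-t, e)
  have hf : LocallyIntegrable f volume :=
    ((integrable_indicator_iff measurableSet_Ioc).2
      (integrableOn_const (by simp) (by simp))).locallyIntegrable
  have hg : ContDiff ℝ ∞ ↿g := by
    have h1 : ContDiff ℝ ∞ fun x : P × ℝ => χ x.2 := χ.contDiff.comp contDiff_snd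
    have h2 : ContDiff ℝ ∞ fun x : P × ℝ => ψ (-x.2, x.1) :=
      hψ.comp (contDiff_snd.neg.prodMk contDiff_fst)
    exact h1.mul h2
  have h := contDiffOn_convolution_right_with_param (μ := volume) (n := ⊤)
    (ContinuousLinearMap.mul ℝ ℝ) (s := Set.univ) (k := Metric.closedBall 0 3) isOpen_univ
    (isCompact_closedBall 0 3) (f := f) (g := g)
    (fun e t _ ht => by
      have : χ t = 0 := χ.zero_of_le_dist (by
        rw [Metric.mem_closedBall, not_le] at ht
        exact ht.le)
      simp [g, this]) hf hg.contDiffOn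
  rw [Set.univ_prod_univ, contDiffOn_univ] at h
  have h2 := h.comp (contDiff_prodMk_left (0 : ℝ) : ContDiff ℝ ∞ fun e : P => (e, (0 : ℝ)))
  convert h2 using 1
  funext e
  rw [intervalIntegral.integral_of_le zero_le_one, ← integral_indicator measurableSet_Ioc]
  refine integral_congr_ae (Filter.Eventually.of_forall fun t => ?_)
  by_cases ht : t ∈ Set.Ioc (0 : ℝ) 1
  · have h1 : χ (-t) = 1 := χ.one_of_mem_closedBall (by
      rw [Metric.mem_closedBall, dist_zero_right, norm_neg, Real.norm_eq_abs, abs_of_pos ht.1]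
      change t ≤ 2
      linarith [ht.2])
    simp [f, g, ht, h1]
  · simp [f, ht]

/-- The fundamental theorem of calculus is applied along the segment from `c` to `e`. -/
lemma exists_hadamard_of_contDiff {φ : E p → ℝ} (hφ : ContDiff ℝ ∞ φ) (c : E p) :
    ∃ G : Fin p → E p → ℝ, (∀ l, ContDiff ℝ ∞ (G l)) ∧
      ∀ e, φ e = φ c + ∑ l, (e l - c l) * G l e := by
  have hfd : ContDiff ℝ ∞ (fderiv ℝ φ) := hφ.fderiv_right (by simp)
  refine ⟨fun l e => ∫ s in (0 : ℝ)..1, fderiv ℝ φ (c + s • (e - c)) (EuclideanSpace.single l 1),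
    fun l => ?_, fun e => ?_⟩
  · refine contDiff_integral_param
      (ψ := fun x => fderiv ℝ φ (c + x.1 • (x.2 - c)) (EuclideanSpace.single l 1)) ?_
    have : ContDiff ℝ ∞ fun x : ℝ × E p => c + x.1 • (x.2 - c) :=
      contDiff_const.add (contDiff_fst.smul (contDiff_snd.sub contDiff_const))
    exact (hfd.comp this).clm_apply contDiff_const
  · have hline : ∀ s : ℝ, HasDerivAt (fun s : ℝ => c + s • (e - c)) (e - c) s := fun s => by
      simpa using ((hasDerivAt_id s).smul_const (e - c)).const_add c
    have hder : ∀ s : ℝ, HasDerivAt (fun s : ℝ => φ (c + s • (e - c)))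
        (fderiv ℝ φ (c + s • (e - c)) (e - c)) s := fun s =>
      ((hφ.differentiable (by simp)) _).hasFDerivAt.comp_hasDerivAt s (hline s)
    have hcl : Continuous fun s : ℝ => fderiv ℝ φ (c + s • (e - c)) :=
      hfd.continuous.comp (by fun_prop)
    have hc : ∀ v : E p, Continuous fun s : ℝ => fderiv ℝ φ (c + s • (e - c)) v := fun v =>
      hcl.clm_apply continuous_const
    have hftc := intervalIntegral.integral_eq_sub_of_hasDerivAt (a := 0) (b := 1)
      (fun s _ => hder s) ((hc (e - c)).intervalIntegrable 0 1)
    have hsum : ∀ s : ℝ, fderiv ℝ φ (c + s • (e - c)) (e - c) =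
        ∑ l, (e l - c l) * fderiv ℝ φ (c + s • (e - c)) (EuclideanSpace.single l 1) := by
      intro s
      have hv : e - c = ∑ l, (e l - c l) • EuclideanSpace.single l (1 : ℝ) := by
        ext k
        simp [Finset.sum_apply, Pi.single_apply]
      conv_lhs => enter [2]; rw [hv]
      simp
    simp only [hsum] at hftc
    rw [intervalIntegral.integral_finsetSum
      (fun l _ => ((hc _).const_mul _ |>.intervalIntegrable 0 1))] at hftc
    simp only [intervalIntegral.integral_const_mul, one_smul, zero_smul, add_zero,
      add_sub_cancel] at hftc
    rw [hftc]
    ring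

lemma contDiff_one_sub_bump_div {c : E p} (χ : ContDiffBump c) :
    ContDiff ℝ ∞ fun e => (1 - χ e) / ‖e - c‖ ^ 2 := by
  rw [contDiff_iff_contDiffAt]
  intro e
  by_cases he : e = c
  · subst he
    refine (contDiffAt_const (c := (0 : ℝ))).congr_of_eventuallyEq ?_
    filter_upwards [χ.eventuallyEq_one] with y hy
    simp [hy]
  · refine (contDiffAt_const.sub χ.contDiffAt).div
      ((contDiff_norm_sq ℝ).contDiffAt.comp e (contDiffAt_id.sub contDiffAt_const)) ?_
    simpa [sub_eq_zero] using he

/-- As `T` need not be star-shaped, segments are available only near `c`. The cut-off function `χ (g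
- g c)` is smooth on the whole space and handles that region; away from `c` one can divide by `‖e -
c‖ ^ 2`. -/
lemma exists_hadamard {T : Set (E p)} (hT : IsOpen T) {g : E p → ℝ} (hg : ContDiffOn ℝ ∞ g T)
    {c : E p} (hc : c ∈ T) : ∃ G : Fin p → E p → ℝ, (∀ l, ContDiffOn ℝ ∞ (G l) T) ∧
      ∀ e ∈ T, g e = g c + ∑ l, (e l - c l) * G l e := by
  obtain ⟨r, hr, hrT⟩ := Metric.isOpen_iff.1 hT c hc
  let χ : ContDiffBump c := ⟨r / 4, r / 2, by positivity, by linarith⟩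
  let φ : E p → ℝ := fun e => χ e * (g e - g c)
  have hφ : ContDiff ℝ ∞ φ := by
    rw [contDiff_iff_contDiffAt]
    intro e
    by_cases he : e ∈ T
    · exact χ.contDiffAt.mul (((hg e he).contDiffAt (hT.mem_nhds he)).sub contDiffAt_const)
    · have hd : r ≤ dist e c := not_lt.1 fun h => he (hrT h)
      refine (contDiffAt_const (c := (0 : ℝ))).congr_of_eventuallyEq ?_
      have : ∀ᶠ y in nhds e, r / 2 < dist y c :=
        (continuous_id.dist continuous_const).continuousAt.eventually_const_lt
          (by simp only [id]; linarith)
      filter_upwards [this] with y hy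
      have : χ y = 0 := χ.zero_of_le_dist hy.le
      simp [φ, this]
  obtain ⟨G, hG, hGe⟩ := exists_hadamard_of_contDiff hφ c
  -- Since `∑ (e l - c l) ^ 2 = ‖e - c‖ ^ 2`, the second term contributes `(1 - χ) (g - g c)`, the
  -- part missing from the cut-off function.
  refine ⟨fun l e => G l e + (e l - c l) * ((1 - χ e) / ‖e - c‖ ^ 2) * (g e - g c),
    fun l => ?_, fun e he => ?_⟩
  · have h1 : ContDiff ℝ ∞ fun e : E p => e l - c l :=
      ((EuclideanSpace.proj l : E p →L[ℝ] ℝ).contDiff).sub contDiff_const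
    exact (hG l).contDiffOn.add (((h1.mul (contDiff_one_sub_bump_div χ)).contDiffOn).mul
      (hg.sub contDiffOn_const))
  · have h1 := hGe e
    simp only [φ, sub_self, mul_zero, zero_add] at h1
    simp only [mul_add, Finset.sum_add_distrib]
    rw [← h1]
    have h2 : ∑ l, (e l - c l) * ((e l - c l) * ((1 - χ e) / ‖e - c‖ ^ 2) * (g e - g c)) =
        (1 - χ e) * (g e - g c) := by
      have h3 : ∀ l, (e l - c l) * ((e l - c l) * ((1 - χ e) / ‖e - c‖ ^ 2) * (g e - g c)) =
          (e l - c l) ^ 2 * (((1 - χ e) / ‖e - c‖ ^ 2) * (g e - g c)) := fun l => by ring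
      have h4 : ∑ l, (e l - c l) ^ 2 = ‖e - c‖ ^ 2 := by
        rw [EuclideanSpace.norm_sq_eq]
        simp
      simp only [h3]
      rw [← Finset.sum_mul, h4]
      by_cases hec : e = c
      · subst hec; simp
      · have : ‖e - c‖ ≠ 0 := by simpa [sub_eq_zero] using hec
        field_simp
    rw [h2]
    ring

end Hadamard

/-! ### Smooth functions, their evaluations and coordinate derivations -/

section Classical

variable {p : ℕ} {M₀ : Type u} [TopologicalSpace M₀] [ChartedSpace (E p) M₀]

/-- Evaluation of smooth functions at a point. -/
def evalAt {V : Opens M₀} (m : V) : Smooth (p := p) V →ₐ[ℝ] ℝ where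
  toFun f := f m
  map_one' := rfl
  map_mul' _ _ := rfl
  map_zero' := rfl
  map_add' _ _ := rfl
  commutes' _ := rfl

lemma evalAt_apply {V : Opens M₀} (m : V) (f : Smooth (p := p) V) : evalAt m f = f m := rfl

instance {V : Opens M₀} : IsReduced (Smooth (p := p) V) where
  eq_zero f := by
    rintro ⟨n, hn⟩
    ext m
    have := congrArg (evalAt m) hn
    rw [map_pow, map_zero] at this
    exact eq_zero_of_pow_eq_zero this

namespace ClassicalCoords

variable {U : Opens M₀} (w : ClassicalCoords p U)

/-- The smooth function with a given coordinate expression. -/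
def ofExpr {F : E p → ℝ} (hF : ContDiffOn ℝ ∞ F w.chart.target) : Smooth (p := p) U :=
  ⟨fun m => F (w.chart m), by
    have h1 : ContMDiffOn 𝓘(ℝ, E p) 𝓘(ℝ, E p) ∞ w.chart w.chart.source :=
      contMDiffOn_of_mem_maximalAtlas w.mem_atlas
    have h2 : ContMDiff 𝓘(ℝ, E p) 𝓘(ℝ, E p) ∞ (fun m : U => w.chart m) :=
      h1.comp_contMDiff contMDiff_subtype_val (fun m => w.mem_source m)
    exact hF.contMDiffOn.comp_contMDiff h2 (fun m => w.apply_mem m)⟩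

lemma pull_chart (h : U → ℝ) (m : U) : w.pull h (w.chart m) = h m := by
  rw [w.pull_apply _ (w.apply_mem m)]
  congr 1
  exact Subtype.ext (w.chart.left_inv (w.mem_source m))

lemma pderiv_apply (i : Fin p) (g : Smooth (p := p) U) (m : U) :
    w.pderiv i g m = fderiv ℝ (w.pull g) (w.chart m) (EuclideanSpace.single i 1) := rfl

lemma exists_hadamard (h : Smooth (p := p) U) (m : U) : ∃ c : Fin p → Smooth (p := p) U,
    h = algebraMap ℝ _ (evalAt m h) +
      ∑ l, (w.coord l - algebraMap ℝ _ (evalAt m (w.coord l))) * c l := by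
  obtain ⟨G, hG, hGe⟩ := SuperInt.exists_hadamard w.chart.open_target (w.contDiffOn_pull h)
    (w.apply_mem m)
  refine ⟨fun l => w.ofExpr (hG l), ?_⟩
  ext m'
  have h1 := hGe _ (w.apply_mem m')
  rw [pull_chart, pull_chart] at h1
  rw [h1, ← evalAt_apply m' (_ + _), map_add, map_sum]
  simp only [map_mul, map_sub, AlgHom.commutes]
  rfl

lemma differentiableAt_pull (g : Smooth (p := p) U) (m : U) :
    DifferentiableAt ℝ (w.pull g) (w.chart m) :=
  ((w.contDiffOn_pull g).contDiffAt (w.chart.open_target.mem_nhds (w.apply_mem m))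
    ).differentiableAt (by simp)

/-- Coordinate expressions are extended by zero outside the chart, so identities are used as
identities of germs, which suffices for `fderiv`. -/
lemma pull_eventuallyEq {F : E p → ℝ} {h : U → ℝ} (hF : ∀ m : U, h m = F (w.chart m)) (m : U) :
    w.pull h =ᶠ[nhds (w.chart m)] F := by
  filter_upwards [w.chart.open_target.mem_nhds (w.apply_mem m)] with e he
  rw [w.pull_apply _ he, hF, w.chart.right_inv he]

/-- The derivation `∂/∂u_{0,i}` of the algebra of smooth functions. -/
def derivation (i : Fin p) : Derivation ℝ (Smooth (p := p) U) (Smooth (p := p) U) :=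
  Derivation.mk'
    { toFun := w.pderiv i
      map_add' := fun f g => by
        ext m
        have h1 := w.pull_eventuallyEq (h := (f + g : Smooth (p := p) U)) (F := w.pull f + w.pull g)
          (fun m => by rw [Pi.add_apply, pull_chart, pull_chart]; rfl) m
        rw [pderiv_apply, h1.fderiv_eq, fderiv_add (w.differentiableAt_pull f m)
          (w.differentiableAt_pull g m)]
        rfl
      map_smul' := fun r f => by
        ext m
        have h1 := w.pull_eventuallyEq (h := (r • f : Smooth (p := p) U)) (F := r • w.pull f)
          (fun m => by rw [Pi.smul_apply, pull_chart]; rfl) m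
        rw [pderiv_apply, h1.fderiv_eq, fderiv_const_smul (w.differentiableAt_pull f m)]
        rfl }
    fun f g => by
      ext m
      have h1 := w.pull_eventuallyEq (h := (f * g : Smooth (p := p) U)) (F := w.pull f * w.pull g)
        (fun m => by rw [Pi.mul_apply, pull_chart, pull_chart]; rfl) m
      change w.pderiv i (f * g) m = _
      rw [pderiv_apply, h1.fderiv_eq, fderiv_mul (w.differentiableAt_pull f m)
        (w.differentiableAt_pull g m), pull_chart, pull_chart]
      rfl

lemma derivation_apply (i : Fin p) (g : Smooth (p := p) U) : w.derivation i g = w.pderiv i g := rfl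

lemma derivation_coord (j l : Fin p) :
    w.derivation j (w.coord l) = if j = l then 1 else 0 := by
  ext m
  have h1 := w.pull_eventuallyEq (h := w.coord l) (F := (EuclideanSpace.proj l : E p →L[ℝ] ℝ))
    (fun m => rfl) m
  rw [derivation_apply, pderiv_apply, h1.fderiv_eq, ContinuousLinearMap.fderiv]
  by_cases hjl : j = l
  · subst hjl
    simp
  · simp [hjl, Ne.symm hjl]

lemma derivation_comm (i j : Fin p) (g : Smooth (p := p) U) :
    w.derivation i (w.derivation j g) = w.derivation j (w.derivation i g) := by
  ext m
  have hcd : ContDiffAt ℝ ∞ (w.pull g) (w.chart m) :=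
    (w.contDiffOn_pull g).contDiffAt (w.chart.open_target.mem_nhds (w.apply_mem m))
  have hsymm : IsSymmSndFDerivAt ℝ (w.pull g) (w.chart m) :=
    hcd.isSymmSndFDerivAt (by
      rw [minSmoothness_of_isRCLikeNormedField]
      exact ENat.LEInfty.out)
  have hd : DifferentiableAt ℝ (fderiv ℝ (w.pull g)) (w.chart m) :=
    (hcd.fderiv_right (m := ∞) (by simp)).differentiableAt (by simp)
  have key : ∀ i j : Fin p, w.derivation i (w.derivation j g) m =
      fderiv ℝ (fderiv ℝ (w.pull g)) (w.chart m) (EuclideanSpace.single i 1)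
        (EuclideanSpace.single j 1) := by
    intro i j
    have h1 := w.pull_eventuallyEq (h := w.derivation j g)
      (F := fun e => fderiv ℝ (w.pull g) e (EuclideanSpace.single j 1)) (fun m => rfl) m
    rw [derivation_apply, pderiv_apply, h1.fderiv_eq,
      fderiv_clm_apply hd (differentiableAt_const _)]
    simp
  rw [key, key]
  exact hsymm _ _

lemma jac_self (m : U) : w.jac w m = 1 := by
  have : (Matrix.of fun i k : Fin p => w.pderiv i (w.coord k) m) = 1 := by
    ext i k
    rw [Matrix.of_apply, ← derivation_apply, derivation_coord, Matrix.one_apply]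
    split_ifs <;> rfl
  rw [jac, this, Matrix.det_one]

lemma relSign_self : w.relSign w = 1 := by
  ext m
  change (SignType.sign (w.jac w m) : ℝ) = 1
  rw [jac_self]
  simp

end ClassicalCoords

end Classical

/-! ### The frame of a coordinate system -/

section Super

variable {p q : ℕ} {M₀ : Type u} [TopologicalSpace M₀] [ChartedSpace (E p) M₀]
  {X : SuperSpace p M₀} {U : Opens M₀}

lemma SuperSpace.isSuperalgebra (X : SuperSpace p M₀) (V : Opens M₀) :
    IsSuperalgebra (X.parity V) :=
  ⟨X.graded V, X.internal V, X.supercomm V⟩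

lemma SuperSpace.res_self (X : SuperSpace p M₀) (h : U ≤ U) (f : X.sec U) : X.res h f = f := by
  have : (homOfLE h).op = 𝟙 (op U) := rfl
  rw [SuperSpace.res, this, X.sheaf.presheaf.map_id]
  rfl

namespace CoordSystem

/-- The presentation of the superfunctions on `V ≤ U` by a coordinate system on `U`. -/
def frameOn (x : CoordSystem q X U) {V : Opens M₀} (hV : V ≤ U) :
    Frame (Smooth (p := p) V) (X.parity V) q where
  isSuper := X.isSuperalgebra V
  γ := x.retr.pullback V hV
  ξ := fun j => X.res hV (x.ξ j)
  even := x.retr.even V hV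
  odd := fun j => X.parity_res hV 1 _ (x.odd j)
  decomp := x.decomp V hV

/-- The presentation of the superfunctions on `U` by a coordinate system on `U`. -/
def frame (x : CoordSystem q X U) : Frame (Smooth (p := p) U) (X.parity U) q where
  isSuper := X.isSuperalgebra U
  γ := x.retr.star
  ξ := x.ξ
  even := x.retr.even U le_rfl
  odd := x.odd
  decomp := fun f => by
    have := x.decomp U le_rfl f
    simp only [X.res_self] at this
    exact this

variable (x : CoordSystem q X U)

lemma body_γ (g : Smooth (p := p) U) : X.body U (x.frame.γ g) = g :=
  x.retr.body_pullback U le_rfl g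

lemma coeff_eq (f : X.sec U) : x.coeff f = x.frame.coeff f := by
  have h := (Classical.choose_spec (x.decomp U le_rfl f)).1
  simp only [X.res_self] at h
  have h' : f = x.frame.ofCoeffs (x.coeff f) := h
  conv_rhs => rw [h', Frame.coeff_ofCoeffs]

lemma top_eq (f : X.sec U) : x.top f = x.frame.top f := by
  rw [top, coeff_eq, Frame.top]

lemma dEven_eq (i : Fin p) (f : X.sec U) :
    x.dEven i f = x.frame.dEven (x.coords.derivation i) f := by
  rw [dEven, Frame.dEven_eq, coeff_eq]
  rfl

lemma dOdd_eq (j : Fin q) (f : X.sec U) : x.dOdd j f = x.frame.dOdd j f := by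
  rw [dOdd, Frame.dOdd_eq, coeff_eq]
  rfl

/-- The coordinate system with the same odd coordinates and other even coordinates. -/
def changeRetr (w : ClassicalCoords p U) (γ : Retraction X U) : CoordSystem q X U where
  coords := w
  retr := γ
  ξ := x.ξ
  odd := x.odd
  decomp V hV f := (x.frameOn hV).decomp_of_retraction (β := X.body V)
    (x.retr.body_pullback V hV) (γ.pullback V hV) (γ.body_pullback V hV) f

end CoordSystem

/-! ### Berezinians of special coordinate changes -/

lemma leibnizDet_map {R A : Type*} [CommRing R] [Ring A] (φ : R →+* A) {n : ℕ}
    (N : Matrix (Fin n) (Fin n) R) : leibnizDet (Matrix.of fun i k => φ (N i k)) = φ N.det := by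
  rw [leibnizDet, Matrix.det_apply, map_sum]
  refine Finset.sum_congr rfl fun σ _ => ?_
  have e : (Equiv.Perm.sign σ • ∏ i, N (σ i) i) =
    (Equiv.Perm.sign σ : ℤ) • (List.ofFn fun i => N (σ i) i).prod := by
    rw [List.prod_ofFn]
    rfl
  rw [e, map_zsmul, map_list_prod, List.map_ofFn]
  rfl

lemma leibnizDet_one {A : Type*} [Ring A] {n : ℕ} :
    leibnizDet (1 : Matrix (Fin n) (Fin n) A) = 1 := by
  have h := leibnizDet_map (Int.castRingHom A) (1 : Matrix (Fin n) (Fin n) ℤ)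
  rw [Matrix.det_one, map_one] at h
  rw [← h]
  congr 1
  ext i k
  by_cases hik : i = k <;> simp [Matrix.one_apply, hik]

/-- The Jacobian determinant as a smooth function. -/
def ClassicalCoords.jacobian (u w : ClassicalCoords p U) : Smooth (p := p) U :=
  Matrix.det (Matrix.of fun i k : Fin p => w.pderiv i (u.coord k))

/-- The factor by which the coefficient of a density or top degree form changes. -/
def Kind.jacobian (k : Kind p U) (u w : ClassicalCoords p U) : Smooth (p := p) U :=
  match k with
  | Kind.density => u.relSign w * u.jacobian w
  | Kind.form _ => u.jacobian w

/-- With a common retraction the even coordinates of `x` are functions pulled back along it,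
independent of the odd coordinates of `y`. So the block `T` vanishes, and the Berezinian splits into
a classical Jacobian and an odd one. -/
lemma ber_of_retr_eq {x y : CoordSystem q X U} (h : x.retr = y.retr) :
    ber x y = y.frame.γ (x.coords.jacobian y.coords) *
      ((y.frame.oddJacobian x.frame (X.isSuperalgebra U)).det :
        (X.isSuperalgebra U).evenPart) := by
  have hγ : x.frame.γ = y.frame.γ := by
    change x.retr.star = y.retr.star
    rw [h]
  have hu : ∀ k, x.u k = y.frame.γ (x.coords.coord k) := fun k => by rw [← hγ]; rfl
  have hT : (Matrix.of fun (i : Fin q) (k : Fin p) => y.dOdd i (x.u k)) = 0 := by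
    ext i k
    rw [Matrix.of_apply, hu, CoordSystem.dOdd_eq, Frame.dOdd_γ]
    rfl
  set hs := X.isSuperalgebra U
  have hcoe : ∀ M N : Matrix (Fin q) (Fin q) hs.evenPart, M * N = 1 →
      (Matrix.of fun i k => (M i k : X.sec U)) * (Matrix.of fun i k => (N i k : X.sec U)) = 1 := by
    intro M N hMN
    have := congrArg (fun P => P.map (hs.evenPart.val : hs.evenPart →+* X.sec U)) hMN
    simp only [Matrix.map_mul, Matrix.map_one _ (map_zero _) (map_one _)] at this
    exact this
  have hVW := hcoe _ _ (Frame.oddJacobian_mul hγ hs)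
  have hWV := hcoe _ _ (Frame.oddJacobian_mul hγ.symm hs)
  have hV : (Matrix.of fun (i k : Fin q) => y.dOdd i (x.ξ k)) =
      Matrix.of fun i k => (x.frame.oddJacobian y.frame hs i k : X.sec U) := by
    ext i k
    rw [Matrix.of_apply, CoordSystem.dOdd_eq]
    rfl
  have hinv : Ring.inverse (Matrix.of fun (i k : Fin q) => y.dOdd i (x.ξ k)) =
      Matrix.of fun i k => (y.frame.oddJacobian x.frame hs i k : X.sec U) := by
    rw [hV]
    exact Ring.inverse_unit ⟨_, _, hVW, hWV⟩
  have hR : (Matrix.of fun (i k : Fin p) => y.dEven i (x.u k)) = Matrix.of fun i k =>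
      (y.frame.γ : _ →+* X.sec U)
        ((Matrix.of fun i k : Fin p => y.coords.pderiv i (x.coords.coord k)) i k) := by
    ext i k
    rw [Matrix.of_apply, hu, CoordSystem.dEven_eq, Frame.dEven_γ]
    rfl
  rw [ber, berezinian, hT, Matrix.mul_zero, sub_zero, hinv, leibnizDet_coe, hR, leibnizDet_map]
  rfl

/-- With common odd coordinates the block `S` is zero and `V` is the identity. -/
lemma ber_of_ξ_eq {x y : CoordSystem q X U} (h : x.ξ = y.ξ) :
    ber x y = leibnizDet (Matrix.of fun i k => y.frame.dEven (y.coords.derivation i) (x.u k)) := by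
  have hS : (Matrix.of fun (i : Fin p) (k : Fin q) => y.dEven i (x.ξ k)) = 0 := by
    ext i k
    rw [Matrix.of_apply, h, CoordSystem.dEven_eq]
    exact y.frame.dEven_ξ _ _
  have hV : (Matrix.of fun (i k : Fin q) => y.dOdd i (x.ξ k)) = 1 := by
    ext i k
    rw [Matrix.of_apply, h, CoordSystem.dOdd_eq, Matrix.one_apply]
    exact y.frame.dOdd_ξ i k
  rw [ber, berezinian, hS, hV, Ring.inverse_one, Matrix.zero_mul, Matrix.zero_mul, sub_zero,
    leibnizDet_one, mul_one]
  congr 1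
  ext i k
  rw [Matrix.of_apply, CoordSystem.dEven_eq]
  rfl

lemma berFactor_of_coords_eq (k : Kind p U) {x y : CoordSystem q X U} (h : x.coords = y.coords) :
    berFactor k x y = ber x y := by
  cases k with
  | density => rw [berFactor, h, ClassicalCoords.relSign_self, map_one, one_mul]
  | form o => rfl

lemma berFactor_self (k : Kind p U) (x : CoordSystem q X U) : berFactor k x x = 1 := by
  rw [berFactor_of_coords_eq k rfl, ber_of_ξ_eq rfl, ← leibnizDet_one]
  congr 1
  ext i k
  have : x.u k = x.frame.γ (x.coords.coord k) := rfl
  rw [Matrix.of_apply, this, Frame.dEven_γ, ClassicalCoords.derivation_coord, Matrix.one_apply]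
  split_ifs <;> simp

lemma top_mul_berFactor (k : Kind p U) {x y : CoordSystem q X U} (h : x.retr = y.retr)
    (f : X.sec U) : y.top (f * berFactor k x y) = k.jacobian x.coords y.coords * x.top f := by
  have hγ : x.frame.γ = y.frame.γ := by
    change x.retr.star = y.retr.star
    rw [h]
  have hber : ∀ g, y.top (f * (y.frame.γ g * ber x y)) =
      g * x.coords.jacobian y.coords * x.top f := by
    intro g
    rw [ber_of_retr_eq h, CoordSystem.top_eq, CoordSystem.top_eq, ← mul_assoc (y.frame.γ g),
      ← map_mul, ← mul_assoc, ← y.frame.γ_comm, mul_assoc, Frame.top_γ_mul,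
      Frame.top_mul_det_oddJacobian y.body_γ hγ]
  cases k with
  | density => exact hber _
  | form o =>
    have := hber 1
    rwa [map_one, one_mul, one_mul] at this

/-! ### Fibre integrals -/

/-- The family `ϖ` arises from its coefficient with respect to `x` by the transformation law. -/
def TransformsFrom (k : Kind p U) (x : CoordSystem q X U) (ϖ : BerFamily q X U) : Prop :=
  ∀ y, ϖ y = ϖ x * berFactor k x y

/-- Whichever coordinate system the definition selects, it shares its retraction with `x`, and the
odd part of the Berezinian leaves the top coefficient unchanged. Only the transformation law
starting from `x` is used, so multiplicativity of Berezinians is not needed for the families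
obtained by differentiation. -/
lemma fibreIntegral_apply (k : Kind p U) (s : ℕ) {x : CoordSystem q X U} {ϖ : BerFamily q X U}
    (hϖ : TransformsFrom k x ϖ) (w : ClassicalCoords p U) (m : U) :
    fibreIntegral s x.retr ϖ w m = (-1) ^ s * (k.jacobian x.coords w m * x.top (ϖ x) m) := by
  have h : ∃ y : CoordSystem q X U, y.coords = w ∧ y.retr = x.retr :=
    ⟨x.changeRetr w x.retr, rfl, rfl⟩
  obtain ⟨h1, h2⟩ := Classical.choose_spec h
  rw [fibreIntegral, dif_pos h]
  change (-1 : ℝ) ^ s * (Classical.choose h).top (ϖ (Classical.choose h)) m = _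
  rw [hϖ (Classical.choose h), top_mul_berFactor k h2.symm, h1]
  rfl

lemma TransformsFrom.act (k : Kind p U) (x : CoordSystem q X U) (l : Fin p)
    (ϖ : BerFamily q X U) : TransformsFrom k x (act k x l ϖ) ∧
      SuperInt.act k x l ϖ x = -x.frame.dEven (x.coords.derivation l) (ϖ x) := by
  have h : SuperInt.act k x l ϖ x = -x.frame.dEven (x.coords.derivation l) (ϖ x) := by
    change -(x.dEven l (ϖ x) * berFactor k x x) = _
    rw [berFactor_self, mul_one, CoordSystem.dEven_eq]
  refine ⟨fun y => ?_, h⟩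
  rw [h, ← CoordSystem.dEven_eq, neg_mul]
  rfl

lemma TransformsFrom.iterate_act {k : Kind p U} {x : CoordSystem q X U} (l : Fin p)
    {ϖ : BerFamily q X U} (hϖ : TransformsFrom k x ϖ) (n : ℕ) :
    TransformsFrom k x ((SuperInt.act k x l)^[n] ϖ) ∧
      (SuperInt.act k x l)^[n] ϖ x =
        ((-x.frame.dEven (x.coords.derivation l)) ^ n) (ϖ x) := by
  induction n with
  | zero => exact ⟨hϖ, rfl⟩
  | succ n ih =>
    rw [Function.iterate_succ_apply']
    refine ⟨(TransformsFrom.act k x l _).1, ?_⟩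
    rw [(TransformsFrom.act k x l _).2, ih.2, pow_succ', Module.End.mul_apply]
    rfl

lemma TransformsFrom.foldr_act {k : Kind p U} {x : CoordSystem q X U} (i : Fin p → ℕ)
    {ϖ : BerFamily q X U} (hϖ : TransformsFrom k x ϖ) (ls : List (Fin p)) :
    TransformsFrom k x (ls.foldr (fun l η => (SuperInt.act k x l)^[i l] η) ϖ) ∧
      ls.foldr (fun l η => (SuperInt.act k x l)^[i l] η) ϖ x =
        ls.foldr (fun l a => ((-x.frame.dEven (x.coords.derivation l)) ^ i l) a) (ϖ x) := by
  induction ls with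
  | nil => exact ⟨hϖ, rfl⟩
  | cons l ls ih =>
    rw [List.foldr_cons, List.foldr_cons, ← ih.2]
    exact ih.1.iterate_act l (i l)

lemma TransformsFrom.mulEven {k : Kind p U} {x : CoordSystem q X U} {ϖ : BerFamily q X U}
    (hϖ : TransformsFrom k x ϖ) {a : X.sec U} (ha : a ∈ X.parity U 0) :
    TransformsFrom k x (SuperInt.mulEven ϖ a) := by
  intro y
  change ϖ y * a = ϖ x * a * berFactor k x y
  rw [hϖ y, mul_assoc, mul_assoc, (X.isSuperalgebra U).even_comm ha]

/-- The Lagrange operator as a sum over multi-indices. -/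
lemma lagrange_eq_sum {ι A : Type*} [Fintype ι] [DecidableEq ι] [Ring A] [Algebra ℝ A]
    (δ : ι → A →ₗ[ℝ] A) (n : ι → A) (hn : ∀ l b, n l * b = b * n l) (K : ℕ) (ls : List ι)
    (hls : ls.Nodup) (f : A) :
    lagrange δ n K ls f =
      ∑ i ∈ Fintype.piFinset fun l => if l ∈ ls then Finset.range (K + 1) else {0},
        ((∏ l, (i l).factorial : ℕ) : ℝ)⁻¹ •
          ls.foldr (fun l a => ((-δ l) ^ i l) a) (f * (ls.map fun l => n l ^ i l).prod) := by
  induction ls generalizing f with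
  | nil =>
    have : (Fintype.piFinset fun l : ι => if l ∈ ([] : List ι) then Finset.range (K + 1) else {0}) =
        {0} := by
      ext i
      simp [funext_iff]
    rw [this, Finset.sum_singleton]
    simp [lagrange]
  | cons l ls ih =>
    rw [List.nodup_cons] at hls
    rw [lagrange_cons]
    simp only [ih hls.2, map_sum, Finset.smul_sum]
    rw [← Finset.sum_product']
    -- Multi-indices supported on `l :: ls` correspond to pairs of the exponent at `l` and a
    -- multi-index that is zero at `l`.
    refine Finset.sum_bij' (fun mi _ => Function.update mi.2 l mi.1)
      (fun i _ => (i l, Function.update i l 0)) ?_ ?_ ?_ ?_ ?_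
    · rintro ⟨m, i⟩ hmi
      obtain ⟨hm, hi⟩ := Finset.mem_product.1 hmi
      rw [Fintype.mem_piFinset] at hi ⊢
      intro l'
      by_cases hl : l' = l
      · subst hl
        simpa using hm
      · simpa [hl] using hi l'
    · intro i hi
      rw [Fintype.mem_piFinset] at hi
      refine Finset.mem_product.2 ⟨by simpa using hi l, Fintype.mem_piFinset.2 fun l' => ?_⟩
      by_cases hl : l' = l
      · subst hl
        simp [hls.1]
      · simpa [hl] using hi l'
    · rintro ⟨m, i⟩ hmi
      obtain ⟨hm, hi⟩ := Finset.mem_product.1 hmi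
      have h0 := (Fintype.mem_piFinset.1 hi) l
      rw [if_neg hls.1, Finset.mem_singleton] at h0
      have : Function.update i l 0 = i := by rw [← h0, Function.update_eq_self]
      simp [this]
    · intro i hi
      simp
    · rintro ⟨m, i⟩ hmi
      obtain ⟨hm, hi⟩ := Finset.mem_product.1 hmi
      have h0 := (Fintype.mem_piFinset.1 hi) l
      rw [if_neg hls.1, Finset.mem_singleton] at h0
      change i l = 0 at h0
      have hne : ∀ l' ∈ ls, Function.update i l m l' = i l' := fun l' hl' =>
        Function.update_of_ne (fun h : l' = l => hls.1 (h ▸ hl')) _ _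
      have h1 : (∏ l', (Function.update i l m l').factorial) =
          m.factorial * ∏ l', (i l').factorial := by
        rw [← Finset.mul_prod_erase _ _ (Finset.mem_univ l),
          ← Finset.mul_prod_erase Finset.univ (fun l' => (i l').factorial) (Finset.mem_univ l), h0,
          Function.update_self, Nat.factorial_zero, one_mul]
        congr 1
        refine Finset.prod_congr rfl fun l' hl' => ?_
        rw [Function.update_of_ne (Finset.ne_of_mem_erase hl')]
      have h2 : (ls.map fun l' => n l' ^ Function.update i l m l') =
          ls.map fun l' => n l' ^ i l' :=
        List.map_congr_left fun l' hl' => by rw [hne l' hl']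
      have h3 : ∀ a, ls.foldr (fun l' a => ((-δ l') ^ Function.update i l m l') a) a =
          ls.foldr (fun l' a => ((-δ l') ^ i l') a) a := fun a =>
        List.foldr_ext _ _ _ fun l' hl' b => by rw [hne l' hl']
      have h4 : ∀ b, n l ^ m * b = b * n l ^ m := fun b =>
        (Commute.pow_left (hn l b : Commute (n l) b) m).eq
      dsimp only
      rw [h1, List.map_cons, List.prod_cons, List.foldr_cons, h2, h3, Function.update_self,
        ← mul_assoc f, ← h4 f, map_smul, smul_smul, Nat.cast_mul, mul_inv]

/-- The pointwise formula for the change of the retraction. -/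
lemma fibreIntegral_eq_sum (k : Kind p U) (s : ℕ) (γ' : Retraction X U) (x : CoordSystem q X U)
    {ϖ : BerFamily q X U} (hϖ : IsBerezin k ϖ) (w : ClassicalCoords p U) (m : U) :
    fibreIntegral s γ' ϖ w m = ∑ i ∈ Fintype.piFinset fun _ : Fin p => Finset.range (q + 1 + 1),
      ((∏ l, (i l).factorial : ℕ) : ℝ)⁻¹ * fibreIntegral s x.retr
        (actMulti k x i (mulEven ϖ (diffPow x.retr γ' x.coords i))) w m := by
  -- Keeping the odd coordinates and the base coordinates of `x` makes the transformation factor the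
  -- determinant `det(∂u/∂v)`, with no relative orientation sign.
  set y : CoordSystem q X U := x.changeRetr x.coords γ' with hy
  have hn0 : ∀ l, γ'.star (x.coords.coord l) - x.retr.star (x.coords.coord l) ∈ X.parity U 0 :=
    fun l => Submodule.sub_mem _ (γ'.even _ _ _) (x.retr.even _ _ _)
  have hpow : ∀ i, diffPow x.retr γ' x.coords i ∈ X.parity U 0 := by
    intro i
    change _ ∈ (X.isSuperalgebra U).evenPart
    refine Subalgebra.list_prod_mem _ fun a ha => ?_
    obtain ⟨l, rfl⟩ := List.mem_ofFn.1 ha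
    exact Subalgebra.pow_mem _ (hn0 l) _
  have hterm : ∀ i, TransformsFrom k x
      (actMulti k x i (mulEven ϖ (diffPow x.retr γ' x.coords i))) ∧
      actMulti k x i (mulEven ϖ (diffPow x.retr γ' x.coords i)) x = _ := fun i =>
    TransformsFrom.foldr_act i (TransformsFrom.mulEven (fun z => hϖ x z) (hpow i))
      (List.finRange p)
  have htop : y.top (ϖ y) = ∑ i ∈ Fintype.piFinset fun _ : Fin p => Finset.range (q + 1 + 1),
      ((∏ l, (i l).factorial : ℕ) : ℝ)⁻¹ •
        x.top (actMulti k x i (mulEven ϖ (diffPow x.retr γ' x.coords i)) x) := by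
    have h1 := Frame.top_mul_leibnizDet (β := X.body U) x.body_γ y.body_γ
      (rfl : x.frame.ξ = y.frame.ξ) x.coords.derivation x.coords.derivation_comm x.coords.coord
      x.coords.derivation_coord evalAt (fun a ha => by ext m; exact ha m) x.coords.exists_hadamard
      (ϖ x)
    have h2 : ϖ y = ϖ x * leibnizDet (Matrix.of fun i k =>
        y.frame.dEven (x.coords.derivation i) (x.frame.γ (x.coords.coord k))) := by
      rw [hϖ x y, berFactor_of_coords_eq k (x := x) (y := y) rfl,
        ber_of_ξ_eq (x := x) (y := y) rfl]
      rfl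
    rw [CoordSystem.top_eq, h2, h1, lagrange_eq_sum _ _ _ _ _ (List.nodup_finRange p),
      Frame.top_sum]
    · have hset : (Fintype.piFinset fun l : Fin p =>
          if l ∈ List.finRange p then Finset.range (q + 1 + 1) else {0}) =
          Fintype.piFinset fun _ : Fin p => Finset.range (q + 1 + 1) := by simp
      rw [hset]
      refine Finset.sum_congr rfl fun i _ => ?_
      rw [Frame.top_smul, (hterm i).2, CoordSystem.top_eq]
      congr 4
      rw [diffPow, List.ofFn_eq_map]
      rfl
    · exact fun l b => (X.isSuperalgebra U).even_comm (hn0 l) b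
  -- As `y` and `x` have the same base coordinates, passing to `w` multiplies both sides by the same
  -- Jacobian factor, so comparing top coefficients is enough.
  have hy' := fibreIntegral_apply k s (x := y) (fun z => hϖ y z) w m
  change fibreIntegral s γ' ϖ w m = _ at hy'
  rw [hy', htop, ← evalAt_apply m (∑ _ ∈ _, _), map_sum, Finset.mul_sum, Finset.mul_sum]
  refine Finset.sum_congr rfl fun i _ => ?_
  rw [fibreIntegral_apply k s (hterm i).1, map_smul, evalAt_apply, smul_eq_mul]
  change _ * (k.jacobian x.coords w m * _) = _
  ring

lemma diffPow_eq_zero (γ' : Retraction X U) (x : CoordSystem q X U) {i : Fin p → ℕ} {l : Fin p}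
    (hl : q < i l) : diffPow x.retr γ' x.coords i = 0 := by
  have h1 : γ'.star (x.coords.coord l) - x.retr.star (x.coords.coord l) ∈ x.frame.filt 1 := by
    rw [x.frame.mem_filt_one_iff x.body_γ, map_sub, sub_eq_zero]
    exact (γ'.body_pullback _ _ _).trans (x.retr.body_pullback _ _ _).symm
  refine List.prod_eq_zero (List.mem_ofFn.2 ⟨l, ?_⟩)
  exact x.frame.pow_eq_zero h1 hl

lemma actMulti_zero_right (k : Kind p U) (x : CoordSystem q X U) (i : Fin p → ℕ) :
    actMulti k x i (0 : BerFamily q X U) = 0 := by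
  have h0 : TransformsFrom k x (0 : BerFamily q X U) := fun y => by simp
  obtain ⟨h1, h2⟩ := h0.foldr_act i (List.finRange p)
  have h3 : ∀ ls : List (Fin p), ls.foldr
      (fun l a => ((-x.frame.dEven (x.coords.derivation l)) ^ i l) a) (0 : X.sec U) = 0 := by
    intro ls
    induction ls with
    | nil => rfl
    | cons l ls ih => rw [List.foldr_cons, ih, map_zero]
  funext y
  have h4 := h1 y
  rw [h2] at h4
  refine h4.trans ?_
  rw [Pi.zero_apply, h3, zero_mul]
  rfl

/-! ### Linearity of integration on the base -/

namespace ClassicalCoords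

lemma pull_sum {κ : Type*} (w : ClassicalCoords p U) (I : Finset κ) (h : κ → U → ℝ) :
    w.pull (fun m => ∑ i ∈ I, h i m) = fun e => ∑ i ∈ I, w.pull (h i) e := by
  funext e
  by_cases he : e ∈ w.chart.target
  · simp [w.pull_apply _ he]
  · simp [pull, he]

lemma pull_const_mul (w : ClassicalCoords p U) (c : ℝ) (h : U → ℝ) :
    w.pull (fun m => c * h m) = fun e => c * w.pull h e := by
  funext e
  by_cases he : e ∈ w.chart.target
  · simp [w.pull_apply _ he]
  · simp [pull, he]

end ClassicalCoords

lemma Kind.pull_weight_mul_sum (k : Kind p U) {κ : Type*} (I : Finset κ) (c : κ → ℝ)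
    (h : κ → TopFamily p U) (w : ClassicalCoords p U) :
    (w.pull fun m => k.weight w m * ∑ i ∈ I, c i * h i w m) =
      fun e => ∑ i ∈ I, c i * w.pull (fun m => k.weight w m * h i w m) e := by
  have : (fun m => k.weight w m * ∑ i ∈ I, c i * h i w m) =
      fun m => ∑ i ∈ I, c i * (k.weight w m * h i w m) := by
    funext m
    rw [Finset.mul_sum]
    exact Finset.sum_congr rfl fun i _ => by ring
  rw [this, ClassicalCoords.pull_sum]
  simp only [ClassicalCoords.pull_const_mul]

lemma Kind.baseIntegrable_sum (k : Kind p U) {κ : Type*} {I : Finset κ} (c : κ → ℝ)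
    {h : κ → TopFamily p U} (hh : ∀ i ∈ I, k.BaseIntegrable (h i)) :
    k.BaseIntegrable fun w m => ∑ i ∈ I, c i * h i w m := by
  intro w
  rw [k.pull_weight_mul_sum]
  exact integrable_finsetSum _ fun i hi => (hh i hi w).const_mul (c i)

/-- All the integrals are evaluated in the same chosen chart, so independence of the chart plays no
role. -/
lemma Kind.baseIntegral_sum (k : Kind p U) {κ : Type*} {I : Finset κ} (c : κ → ℝ)
    {h : κ → TopFamily p U} (hh : ∀ i ∈ I, k.BaseIntegrable (h i)) :
    k.baseIntegral (fun w m => ∑ i ∈ I, c i * h i w m) =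
      ∑ i ∈ I, c i * k.baseIntegral (h i) := by
  by_cases hw : Nonempty (ClassicalCoords p U)
  · simp only [Kind.baseIntegral, dif_pos hw]
    rw [k.pull_weight_mul_sum, integral_finsetSum _ fun i hi => (hh i hi _).const_mul (c i)]
    simp only [integral_const_mul]
  · simp [Kind.baseIntegral, dif_neg hw]

end Super

end SuperInt

end

/-! ### Integration of the pointwise formula -/

theorem mainTheorem4 {p q : ℕ} {M₀ : Type*} [TopologicalSpace M₀] [T2Space M₀]
    [SecondCountableTopology M₀] [ChartedSpace (SuperInt.E p) M₀]
    [IsManifold 𝓘(ℝ, SuperInt.E p) ∞ M₀]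
    (M : SuperInt.Supermanifold p q M₀) (U : Opens M₀) (hU : M.IsCoordNhd U)
    (γ γ' : SuperInt.Retraction M.toSuperSpace U) (u₀ : SuperInt.ClassicalCoords p U)
    (s : ℕ) (k : SuperInt.Kind p U)
    (ϖ : SuperInt.BerFamily q M.toSuperSpace U) (hϖ : SuperInt.IsBerezin k ϖ) :
    (∃ x : SuperInt.CoordSystem q M.toSuperSpace U, x.coords = u₀ ∧ x.retr = γ) ∧
    ∀ x : SuperInt.CoordSystem q M.toSuperSpace U, x.coords = u₀ → x.retr = γ →
      {i : Fin p → ℕ | SuperInt.actMulti k x i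
        (SuperInt.mulEven ϖ (SuperInt.diffPow γ γ' u₀ i)) ≠ 0}.Finite ∧
      (SuperInt.IntegrableWrt k s γ ϖ →
        (∀ i : Fin p → ℕ, i ≠ 0 → SuperInt.IntegrableWrt k s γ
          (SuperInt.actMulti k x i (SuperInt.mulEven ϖ (SuperInt.diffPow γ γ' u₀ i)))) →
        SuperInt.IntegrableWrt k s γ' ϖ ∧
        SuperInt.integralWrt k s γ' ϖ = SuperInt.integralWrt k s γ ϖ +
          ∑ᶠ (i : Fin p → ℕ) (_ : i ≠ 0), (1 / ((∏ l, (i l).factorial : ℕ) : ℝ)) *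
            SuperInt.integralWrt k s γ
              (SuperInt.actMulti k x i (SuperInt.mulEven ϖ (SuperInt.diffPow γ γ' u₀ i)))) := by
  refine ⟨?_, ?_⟩
  · obtain ⟨x⟩ := hU
    exact ⟨x.changeRetr u₀ γ, rfl, rfl⟩
  rintro x rfl rfl
  set T : (Fin p → ℕ) → SuperInt.BerFamily q M.toSuperSpace U := fun i =>
    SuperInt.actMulti k x i (SuperInt.mulEven ϖ (SuperInt.diffPow x.retr γ' x.coords i)) with hT
  -- The box of exponents at most `q + 1`; outside it some exponent exceeds `q`, so the power of the
  -- difference is zero.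
  set I : Finset (Fin p → ℕ) := Fintype.piFinset fun _ => Finset.range (q + 1 + 1) with hI
  have hTI : ∀ i, i ∉ I → T i = 0 := by
    intro i hi
    obtain ⟨l, hl⟩ : ∃ l, q < i l := by
      by_contra! hall
      refine hi (Fintype.mem_piFinset.2 fun l => Finset.mem_range.2 ?_)
      have := hall l
      omega
    have h0 : SuperInt.mulEven ϖ (0 : M.toSuperSpace.sec U) = 0 := by
      funext y
      exact mul_zero _
    simp only [hT]
    rw [SuperInt.diffPow_eq_zero γ' x hl, h0, SuperInt.actMulti_zero_right]
  -- The index `0` accounts for the separate first term and for the separate integrability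
  -- hypothesis.
  have hT0 : T 0 = ϖ := by
    have h1 : SuperInt.diffPow x.retr γ' x.coords 0 = 1 := by
      refine List.prod_eq_one fun a ha => ?_
      obtain ⟨l, rfl⟩ := List.mem_ofFn.1 ha
      exact pow_zero _
    have h2 : ∀ ls : List (Fin p), ls.foldr
        (fun l η => (SuperInt.act k x l)^[(0 : Fin p → ℕ) l] η) ϖ = ϖ := by
      intro ls
      induction ls with
      | nil => rfl
      | cons l ls ih => rw [List.foldr_cons, ih]; rfl
    have h3 : SuperInt.mulEven ϖ (1 : M.toSuperSpace.sec U) = ϖ := by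
      funext y
      exact mul_one _
    simp only [hT]
    rw [h1, h3]
    exact h2 _
  refine ⟨I.finite_toSet.subset fun i hi => ?_, fun hint hints => ?_⟩
  · by_contra hiI
    exact hi (hTI i hiI)
  have hall : ∀ i, SuperInt.IntegrableWrt k s x.retr (T i) := by
    intro i
    by_cases hi : i = 0
    · rw [hi, hT0]
      exact hint
    · exact hints i hi
  have hsum : SuperInt.fibreIntegral s γ' ϖ = fun w m => ∑ i ∈ I,
      ((∏ l, (i l).factorial : ℕ) : ℝ)⁻¹ * SuperInt.fibreIntegral s x.retr (T i) w m := by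
    funext w m
    exact SuperInt.fibreIntegral_eq_sum k s γ' x hϖ w m
  refine ⟨?_, ?_⟩
  · rw [SuperInt.IntegrableWrt, hsum]
    exact k.baseIntegrable_sum _ fun i _ => hall i
  have h0I : (0 : Fin p → ℕ) ∈ I := Fintype.mem_piFinset.2 fun l => by simp
  have hzero : SuperInt.integralWrt k s x.retr
      (0 : SuperInt.BerFamily q M.toSuperSpace U) = 0 := by
    have h1 : ∀ w m, SuperInt.fibreIntegral s x.retr
        (0 : SuperInt.BerFamily q M.toSuperSpace U) w m = 0 := by
      intro w m
      rw [SuperInt.fibreIntegral_apply k s (x := x) (fun y => by simp)]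
      have : x.top (0 : M.toSuperSpace.sec U) = 0 := by
        rw [SuperInt.CoordSystem.top_eq, SuperInt.Frame.top, map_zero]
        rfl
      rw [Pi.zero_apply]
      change _ * (_ * x.top (0 : M.toSuperSpace.sec U) m) = 0
      rw [this]
      change _ * (_ * (0 : ℝ)) = 0
      ring
    -- The empty sum gives the integral of zero, whether or not a classical chart exists.
    have h2 := k.baseIntegral_sum (I := (∅ : Finset ℕ)) (fun _ => 0)
      (h := fun _ => SuperInt.fibreIntegral s x.retr ϖ) (by simp)
    rw [Finset.sum_empty] at h2
    rw [SuperInt.integralWrt, ← h2]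
    congr 1
    funext w m
    rw [h1, Finset.sum_empty]
  rw [SuperInt.integralWrt, hsum, k.baseIntegral_sum _ fun i _ => hall i,
    ← Finset.add_sum_erase _ _ h0I, hT0]
  congr 1
  · simp [SuperInt.integralWrt]
  · rw [finsum_eq_sum_of_support_subset (s := I.erase 0)]
    · refine Finset.sum_congr rfl fun i hi => ?_
      rw [finsum_eq_if, if_pos (Finset.ne_of_mem_erase hi), one_div]
      rfl
    · intro i hi
      rw [Function.mem_support, finsum_eq_if] at hi
      have hi0 : i ≠ 0 := fun h => hi (if_neg (not_not.2 h))
      rw [if_pos hi0] at hi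
      refine Finset.mem_coe.2 (Finset.mem_erase.2 ⟨hi0, ?_⟩)
      by_contra hiI
      apply hi
      change _ * SuperInt.integralWrt k s x.retr (T i) = 0
      rw [hTI i hiI, hzero, mul_zero]
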